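/- Let $r,N\ge 0$, let $e^1,\dots,e^{r+1}$ be the standard basis of $\mathbb R^{r+1}$, let $E_r=\{a\in\mathbb R^{r+1}:\sum_i a_i=0\}$ and $A_r^+=\{e^i-e^j: 1\le i<j\le r+1\}$. Let $\Phi=(\alpha^1,\dots,\alpha^N)$ be a sequence of elements of $A_r^+$ (repetitions allowed) spanning $E_r$, and let $m_{ij}$ ($i<j$) be the multiplicity of $e^i-e^j$ in $\Phi$. Let $\Delta^+$ be any set with $\{\alpha^1,\dots,\alpha^N\}\subseteq\Delta^+\subseteq A_r^+$ and $\Delta=\Delta^+\cup(-\Delta^+)$. Put $V=\{x\in\mathbb R^{r+1}: x_{r+1}=0\}$, with coordinates $x_1,\dots,x_r$, and identify $a\in E_r$ with the linear form $\langle a,x\rangle=\sum_{i=1}^r a_ix_i$ on $V$, so that $E_r=V^*$. Let $R_\Delta$ be the ring of real rational functions generated by the polynomials in $x_1,\dots,x_r$ and the inverses of the forms in $\Delta$; let $S_\Delta\subseteq R_\Delta$ be the real span of the functions $f_\sigma=1/\prod_{\alpha\in\sigma}\alpha$, where $\sigma\subseteq\Delta$ is a basis of $E_r$; and let $\partial(V)R_\Delta=\sum_{k=1}^r\partial_{x_k}R_\Delta$.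 Then $R_\Delta=S_\Delta\oplus\partial(V)R_\Delta$. Let $\mathrm{Tres}_\Delta:R_\Delta\to S_\Delta$ be the projection given by this decomposition, and extend it to $\Delta^{-1}\mathbb R[[x_1,\dots,x_r]]$ by letting $\mathrm{Tres}_\Delta(F)$ be the total residue of the homogeneous component of degree $-r$ of $F$. For $a=(a_1,\dots,a_r)\in\mathbb R^r$ let $\mathbf a=\sum_{i=1}^r a_ie^i-\big(\sum_{i=1}^r a_i\big)e^{r+1}\in E_r$ and $$J_\Phi(a)=\mathrm{Tres}_\Delta\Big(\frac{e^{\langle\mathbf a,x\rangle}}{\prod_{k=1}^N\langle\alpha^k,x\rangle}\Big),\qquad K_\Phi(a)=\mathrm{Tres}_\Delta\Big(\frac{e^{\langle\mathbf a,x\rangle}}{\prod_{k=1}^N(1-e^{-\langle\alpha^k,x\rangle})}\Big),$$ and for $\mathbf i=(i_1,\dots,i_r)\in\mathbb Z_{\ge0}^r$ with $|\mathbf i|=i_1+\dots+i_r=N-r$ let $f_\Phi(\mathbf i)=\mathrm{Tres}_\Delta\big(x_1^{i_1}\cdots x_r^{i_r}/\prod_{k=1}^N\langle\alpha^k,x\rangle\big)\in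 S_\Delta$. For $1\le j\le r$ let $$t_j^\Phi=\sum_{k=j+1}^{r+1}m_{jk}-1,\qquad s_j^\Phi=1-\sum_{k=1}^{j-1}m_{kj},$$ and write $\binom uk=\frac{u(u-1)\cdots(u-k+1)}{k!}$ and $\left(\!\binom uk\!\right)=\frac{u(u+1)\cdots(u+k-1)}{k!}$. Then, for all $a\in\mathbb R^r$, $$J_\Phi(a)=\sum_{|\mathbf i|=N-r}f_\Phi(\mathbf i)\,\frac{a_1^{i_1}}{i_1!}\cdots\frac{a_r^{i_r}}{i_r!},$$ $$K_\Phi(a)=\sum_{|\mathbf i|=N-r}f_\Phi(\mathbf i)\binom{a_1+t_1^\Phi}{i_1}\cdots\binom{a_r+t_r^\Phi}{i_r},$$ $$K_\Phi(a)=\sum_{|\mathbf i|=N-r}f_\Phi(\mathbf i)\left(\!\binom{a_1+s_1^\Phi}{i_1}\!\right)\cdots\left(\!\binom{a_r+s_r^\Phi}{i_r}\!\right).$$ -/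

import Mathlib

namespace TotalRes

noncomputable section

/-! ### The root system `A_r` inside `ℝ^{r+1}` (indices `0, …, r` instead of `1, …, r+1`) -/

/-- The root `e^i - e^j` in `ℝ^{r+1}`. -/
def root {r : ℕ} (i j : Fin (r + 1)) : Fin (r + 1) → ℝ :=
  Pi.single i 1 - Pi.single j 1

/-- The positive root system `A_r⁺ = {e^i - e^j : i < j}`. -/
def posRoots (r : ℕ) : Set (Fin (r + 1) → ℝ) :=
  {α | ∃ i j : Fin (r + 1), i < j ∧ α = root i j}

/-- The space `E_r` of vectors of `ℝ^{r+1}` whose coordinates add up to `0`. -/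
def rootSpace (r : ℕ) : Submodule ℝ (Fin (r + 1) → ℝ) where
  carrier := {a | ∑ i, a i = 0}
  zero_mem' := by simp
  add_mem' := by
    intro a b ha hb
    simp only [Set.mem_ofPred_eq] at ha hb ⊢
    simp [Finset.sum_add_distrib, ha, hb]
  smul_mem' := by
    intro c a ha
    simp only [Set.mem_ofPred_eq] at ha ⊢
    simp [← Finset.mul_sum, ha]

/-- The element `a_1 e^1 + ⋯ + a_r e^r - (a_1 + ⋯ + a_r) e^{r+1}` of `E_r`. -/
def bold {r : ℕ} (a : Fin r → ℝ) : Fin (r + 1) → ℝ :=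
  Fin.snoc (α := fun _ => ℝ) a (-∑ i, a i)

/-- The symmetric system `Δ = Δ⁺ ∪ -Δ⁺`. -/
def symm {r : ℕ} (D : Set (Fin (r + 1) → ℝ)) : Set (Fin (r + 1) → ℝ) :=
  D ∪ {α | -α ∈ D}

/-! ### Rational functions on `V = {x ∈ ℝ^{r+1} : x_{r+1} = 0}`, with coordinates `x_1, …, x_r` -/

/-- The field of rational functions in `x_1, …, x_r`. -/
abbrev RatFun (r : ℕ) : Type := FractionRing (MvPolynomial (Fin r) ℝ)

/-- The field of fractions of the ring of formal power series in `x_1, …, x_r`. -/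
abbrev HatFun (r : ℕ) : Type := FractionRing (MvPowerSeries (Fin r) ℝ)

/-- The linear form `x ↦ ∑_{i ≤ r} a_i x_i` on `V` given by `a ∈ ℝ^{r+1}` (`x_{r+1} = 0` on `V`);
this identifies `E_r` with `V^*`. -/
def linForm {r : ℕ} (a : Fin (r + 1) → ℝ) : MvPolynomial (Fin r) ℝ :=
  ∑ i : Fin r, MvPolynomial.C (a i.castSucc) * MvPolynomial.X i

/-- The product of the linear forms in a finite multiset. -/
def formProd {r : ℕ} (l : Multiset (Fin (r + 1) → ℝ)) : MvPolynomial (Fin r) ℝ :=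
  (l.map linForm).prod

/-- A polynomial as a rational function. -/
def toRat {r : ℕ} (p : MvPolynomial (Fin r) ℝ) : RatFun r :=
  algebraMap (MvPolynomial (Fin r) ℝ) (RatFun r) p

/-- A formal power series as an element of its field of fractions. -/
def toHat {r : ℕ} (p : MvPowerSeries (Fin r) ℝ) : HatFun r :=
  algebraMap (MvPowerSeries (Fin r) ℝ) (HatFun r) p

/-- The ring `R_Δ` generated by the polynomials and the inverses of the linear forms in `Δ`. -/
def ratRing {r : ℕ} (Δ : Set (Fin (r + 1) → ℝ)) : Subalgebra ℝ (RatFun r) :=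
  Algebra.adjoin ℝ (Set.range toRat ∪ {f | ∃ α ∈ Δ, f = (toRat (linForm α))⁻¹})

/-- The finite set `σ` is a basis of `Δ`: it is contained in `Δ` and is a basis of `E_r = V^*`. -/
def IsBasisOf {r : ℕ} (Δ : Set (Fin (r + 1) → ℝ)) (σ : Finset (Fin (r + 1) → ℝ)) : Prop :=
  (σ : Set (Fin (r + 1) → ℝ)) ⊆ Δ ∧
    LinearIndepOn ℝ id (σ : Set (Fin (r + 1) → ℝ)) ∧
    Submodule.span ℝ (σ : Set (Fin (r + 1) → ℝ)) = rootSpace r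

/-- The space `S_Δ` of simple elements, spanned by the `f_σ = 1 / ∏_{α ∈ σ} α`. -/
def simpleSpace {r : ℕ} (Δ : Set (Fin (r + 1) → ℝ)) : Submodule ℝ (RatFun r) :=
  Submodule.span ℝ {f | ∃ σ : Finset (Fin (r + 1) → ℝ),
    IsBasisOf Δ σ ∧ f = (∏ α ∈ σ, toRat (linForm α))⁻¹}

/-- The space `∂(V) R_Δ` spanned by the partial derivatives of the elements `P / Q` of `R_Δ`,
where `P` is a polynomial and `Q` is a product of elements of `Δ`. -/
def derivSpace {r : ℕ} (Δ : Set (Fin (r + 1) → ℝ)) : Submodule ℝ (RatFun r) :=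
  Submodule.span ℝ {f | ∃ (k : Fin r) (P : MvPolynomial (Fin r) ℝ)
    (l : Multiset (Fin (r + 1) → ℝ)), (∀ α ∈ l, α ∈ Δ) ∧
      f = toRat (MvPolynomial.pderiv k P * formProd l - P * MvPolynomial.pderiv k (formProd l)) /
        toRat (formProd l) ^ 2}

open Classical in
/-- The total residue `Tres_Δ : R_Δ → S_Δ`: the projection onto `S_Δ` along `∂(V) R_Δ`
(with value `0` where no projection exists). -/
def tresRat {r : ℕ} (Δ : Set (Fin (r + 1) → ℝ)) (f : RatFun r) : simpleSpace Δ :=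
  if h : ∃ g : simpleSpace Δ, f - (g : RatFun r) ∈ derivSpace Δ then h.choose else 0

/-! ### Extension of the total residue to `Δ⁻¹ ℝ[[x_1, …, x_r]]` -/

/-- The ring `Δ⁻¹ ℝ[[x_1, …, x_r]]` of fractions `P / Q`, where `P` is a formal power series and
`Q` is a product of elements of `Δ`. -/
def hatRing {r : ℕ} (Δ : Set (Fin (r + 1) → ℝ)) : Set (HatFun r) :=
  {F | ∃ (P : MvPowerSeries (Fin r) ℝ) (l : Multiset (Fin (r + 1) → ℝ)),
    (∀ α ∈ l, α ∈ Δ) ∧ F = toHat P / toHat (formProd l : MvPowerSeries (Fin r) ℝ)}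

/-- The homogeneous component of degree `d` of a formal power series, as a polynomial. -/
def homPoly {r : ℕ} (d : ℕ) (P : MvPowerSeries (Fin r) ℝ) : MvPolynomial (Fin r) ℝ :=
  MvPolynomial.homogeneousComponent d (MvPowerSeries.truncTotal (d + 1) P)

/-- `g` is the homogeneous component of degree `-r` of `F ∈ Δ⁻¹ ℝ[[x_1, …, x_r]]`: if
`F = P / Q` with `Q` a product of `n` elements of `Δ`, it is `P_{n-r} / Q`
(and it is `0` if `n < r`). -/
def IsHomPart {r : ℕ} (Δ : Set (Fin (r + 1) → ℝ)) (F : HatFun r) (g : RatFun r) : Prop :=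
  ∃ (P : MvPowerSeries (Fin r) ℝ) (l : Multiset (Fin (r + 1) → ℝ)),
    (∀ α ∈ l, α ∈ Δ) ∧ F = toHat P / toHat (formProd l : MvPowerSeries (Fin r) ℝ) ∧
    g = if r ≤ Multiset.card l then toRat (homPoly (Multiset.card l - r) P) / toRat (formProd l)
      else 0

open Classical in
/-- The homogeneous component of degree `-r` of an element of `Δ⁻¹ ℝ[[x_1, …, x_r]]`
(`0` for other elements of the field of fractions). -/
def homPart {r : ℕ} (Δ : Set (Fin (r + 1) → ℝ)) (F : HatFun r) : RatFun r :=
  if h : ∃ g, IsHomPart Δ F g then h.choose else 0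

/-- The total residue on `Δ⁻¹ ℝ[[x_1, …, x_r]]`: the total residue of the homogeneous component
of degree `-r`. -/
def tres {r : ℕ} (Δ : Set (Fin (r + 1) → ℝ)) (F : HatFun r) : simpleSpace Δ :=
  tresRat Δ (homPart Δ F)

/-! ### The functions `J_Φ` and `K_Φ` -/

/-- The Taylor series of `x ↦ e^{⟨a, x⟩}`. -/
def expForm {r : ℕ} (a : Fin (r + 1) → ℝ) : MvPowerSeries (Fin r) ℝ :=
  (PowerSeries.exp ℝ).subst (linForm a : MvPowerSeries (Fin r) ℝ)

/-- The function `e^a / ∏_{α ∈ Φ} α`. -/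
def jFun {r N : ℕ} (Φ : Fin N → Fin (r + 1) → ℝ) (a : Fin r → ℝ) : HatFun r :=
  toHat (expForm (bold a)) / ∏ k, toHat (linForm (Φ k) : MvPowerSeries (Fin r) ℝ)

/-- The function `e^a / ∏_{α ∈ Φ} (1 - e^{-α})`. -/
def kFun {r N : ℕ} (Φ : Fin N → Fin (r + 1) → ℝ) (a : Fin r → ℝ) : HatFun r :=
  toHat (expForm (bold a)) / ∏ k, toHat (1 - expForm (-Φ k))

/-- `J_Φ(a) = Tres_Δ (e^a / ∏_{α ∈ Φ} α)`. -/
def J {r N : ℕ} (Δ : Set (Fin (r + 1) → ℝ)) (Φ : Fin N → Fin (r + 1) → ℝ) (a : Fin r → ℝ) :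
    simpleSpace Δ :=
  tres Δ (jFun Φ a)

/-- `K_Φ(a) = Tres_Δ (e^a / ∏_{α ∈ Φ} (1 - e^{-α}))`. -/
def K {r N : ℕ} (Δ : Set (Fin (r + 1) → ℝ)) (Φ : Fin N → Fin (r + 1) → ℝ) (a : Fin r → ℝ) :
    simpleSpace Δ :=
  tres Δ (kFun Φ a)

/-- `f_Φ(i) = Tres_Δ (x_1^{i_1} ⋯ x_r^{i_r} / ∏_{α ∈ Φ} α)`. -/
def fCoeff {r N : ℕ} (Δ : Set (Fin (r + 1) → ℝ)) (Φ : Fin N → Fin (r + 1) → ℝ) (i : Fin r → ℕ) :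
    simpleSpace Δ :=
  tresRat Δ (toRat (∏ j, MvPolynomial.X j ^ i j) / ∏ k, toRat (linForm (Φ k)))

/-- The multiplicity `m_{ij}` of the root `e^i - e^j` in the sequence `Φ`. -/
def mult {r N : ℕ} (Φ : Fin N → Fin (r + 1) → ℝ) (i j : Fin (r + 1)) : ℕ :=
  Nat.card {k : Fin N // Φ k = root i j}

/-- `t_j = ∑_{k > j} m_{jk} - 1`. -/
def tShift {r N : ℕ} (Φ : Fin N → Fin (r + 1) → ℝ) (j : Fin r) : ℝ :=
  (∑ k ∈ Finset.Ioi j.castSucc, (mult Φ j.castSucc k : ℝ)) - 1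

/-- `s_j = 1 - ∑_{k < j} m_{kj}`. -/
def sShift {r N : ℕ} (Φ : Fin N → Fin (r + 1) → ℝ) (j : Fin r) : ℝ :=
  1 - ∑ k ∈ Finset.Iio j.castSucc, (mult Φ k j.castSucc : ℝ)

/-- The binomial coefficient `u (u - 1) ⋯ (u - k + 1) / k!`. -/
def binom (u : ℝ) (k : ℕ) : ℝ :=
  (∏ m ∈ Finset.range k, (u - m)) / k.factorial

/-- The rising binomial coefficient `u (u + 1) ⋯ (u + k - 1) / k!`. -/
def risingBinom (u : ℝ) (k : ℕ) : ℝ :=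
  (∏ m ∈ Finset.range k, (u + m)) / k.factorial

/-! ### The objects above are well defined -/

theorem formProd_isHomogeneous {r : ℕ} (l : Multiset (Fin (r + 1) → ℝ)) :
    (formProd l).IsHomogeneous (Multiset.card l) := by
  induction l using Multiset.induction_on with
  | empty => simpa [formProd] using MvPolynomial.isHomogeneous_one (Fin r) ℝ
  | cons a l ih =>
    have h1 : (linForm a).IsHomogeneous 1 := by
      refine MvPolynomial.IsHomogeneous.sum _ _ _ fun i _ => ?_
      simpa using (MvPolynomial.isHomogeneous_C (Fin r) (a i.castSucc)).mul
        (MvPolynomial.isHomogeneous_X ℝ i)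
    have h2 : formProd (a ::ₘ l) = linForm a * formProd l := by simp [formProd]
    rw [h2, Multiset.card_cons, add_comm]
    exact h1.mul ih

theorem degree_of_coeff_ne_zero {r n : ℕ} {Q : MvPolynomial (Fin r) ℝ} (hQ : Q.IsHomogeneous n)
    {m : Fin r →₀ ℕ} (hm : Q.coeff m ≠ 0) : m.degree = n := by
  have h : m.degree = Finsupp.weight 1 m := by
    rw [Finsupp.degree_eq_weight_one]
    rfl
  rw [h]
  exact hQ hm

theorem coeff_homPoly {r : ℕ} (d : ℕ) (P : MvPowerSeries (Fin r) ℝ) (m : Fin r →₀ ℕ) :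
    (homPoly d P).coeff m = if m.degree = d then MvPowerSeries.coeff m P else 0 := by
  rw [homPoly, MvPolynomial.coeff_homogeneousComponent]
  split_ifs with h
  · rw [MvPowerSeries.coeff_truncTotal _ (by omega)]
  · rfl

theorem homPoly_mul {r d n : ℕ} (P : MvPowerSeries (Fin r) ℝ) {Q : MvPolynomial (Fin r) ℝ}
    (hQ : Q.IsHomogeneous n) :
    homPoly (d + n) (P * (Q : MvPowerSeries (Fin r) ℝ)) = homPoly d P * Q := by
  classical
  ext m
  rw [coeff_homPoly, MvPolynomial.coeff_mul, MvPowerSeries.coeff_mul]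
  simp only [coeff_homPoly, MvPolynomial.coeff_coe]
  split_ifs with h
  · refine Finset.sum_congr rfl fun x hx => ?_
    by_cases hq : Q.coeff x.2 = 0
    · simp [hq]
    · have h1 := degree_of_coeff_ne_zero hQ hq
      have h2 : x.1.degree + x.2.degree = m.degree := by
        rw [← Finset.HasAntidiagonal.mem_antidiagonal.mp hx, map_add]
      rw [if_pos (by omega)]
  · refine (Finset.sum_eq_zero fun x hx => ?_).symm
    by_cases hq : Q.coeff x.2 = 0
    · simp [hq]
    · have h1 := degree_of_coeff_ne_zero hQ hq
      have h2 : x.1.degree + x.2.degree = m.degree := by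
        rw [← Finset.HasAntidiagonal.mem_antidiagonal.mp hx, map_add]
      rw [if_neg (by omega), zero_mul]

theorem homPoly_mul_eq_zero {r d n : ℕ} (hd : d < n) (P : MvPowerSeries (Fin r) ℝ)
    {Q : MvPolynomial (Fin r) ℝ} (hQ : Q.IsHomogeneous n) :
    homPoly d (P * (Q : MvPowerSeries (Fin r) ℝ)) = 0 := by
  classical
  ext m
  rw [coeff_homPoly, MvPowerSeries.coeff_mul]
  simp only [MvPolynomial.coeff_coe, MvPolynomial.coeff_zero]
  split_ifs with h
  · refine Finset.sum_eq_zero fun x hx => ?_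
    by_cases hq : Q.coeff x.2 = 0
    · simp [hq]
    · have h1 := degree_of_coeff_ne_zero hQ hq
      have h2 : x.1.degree + x.2.degree = m.degree := by
        rw [← Finset.HasAntidiagonal.mem_antidiagonal.mp hx, map_add]
      omega
  · rfl

theorem linForm_ne_zero {r : ℕ} {D : Set (Fin (r + 1) → ℝ)} (hD : D ⊆ posRoots r)
    {α : Fin (r + 1) → ℝ} (hα : α ∈ symm D) : linForm α ≠ 0 := by
  have key : ∀ β ∈ posRoots r, linForm β ≠ 0 := by
    rintro β ⟨i, j, hij, rfl⟩ h0
    have hi : i ≠ Fin.last r := (lt_of_lt_of_le hij (Fin.le_last j)).ne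
    obtain ⟨i', rfl⟩ := Fin.exists_castSucc_eq.mpr hi
    have h1 := congrArg (MvPolynomial.eval (Pi.single i' (1 : ℝ))) h0
    simp [linForm, root, Pi.single_apply, hij.ne] at h1
  have hneg : linForm (-α) = -linForm α := by simp [linForm]
  rcases hα with h | h
  · exact key α (hD h)
  · intro h0
    exact key (-α) (hD h) (by rw [hneg, h0, neg_zero])

theorem formProd_ne_zero {r : ℕ} {D : Set (Fin (r + 1) → ℝ)} (hD : D ⊆ posRoots r)
    {l : Multiset (Fin (r + 1) → ℝ)} (hl : ∀ α ∈ l, α ∈ symm D) : formProd l ≠ 0 := by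
  rw [formProd, Ne, Multiset.prod_eq_zero_iff, Multiset.mem_map]
  rintro ⟨α, hα, h0⟩
  exact linForm_ne_zero hD (hl α hα) h0

/-- The homogeneous component of degree `-r` does not depend on the fraction. -/
theorem isHomPart_unique {r : ℕ} {D : Set (Fin (r + 1) → ℝ)} (hD : D ⊆ posRoots r)
    {F : HatFun r} {g g' : RatFun r} (hg : IsHomPart (symm D) F g)
    (hg' : IsHomPart (symm D) F g') : g = g' := by
  obtain ⟨P, l, hl, hF, rfl⟩ := hg
  obtain ⟨P', l', hl', hF', rfl⟩ := hg'
  have hq := formProd_ne_zero hD hl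
  have hq' := formProd_ne_zero hD hl'
  have hcoe : ∀ p : MvPolynomial (Fin r) ℝ, p ≠ 0 →
      toHat (p : MvPowerSeries (Fin r) ℝ) ≠ 0 := by
    intro p hp h0
    have h1 := (IsFractionRing.injective (MvPowerSeries (Fin r) ℝ) (HatFun r))
      (h0.trans (map_zero _).symm)
    exact hp (MvPolynomial.coe_eq_zero_iff.mp h1)
  have hrat : ∀ p : MvPolynomial (Fin r) ℝ, p ≠ 0 → toRat p ≠ 0 := by
    intro p hp h0
    exact hp ((IsFractionRing.injective (MvPolynomial (Fin r) ℝ) (RatFun r))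
      (h0.trans (map_zero _).symm))
  have hPP : P * (formProd l' : MvPowerSeries (Fin r) ℝ) = P' * formProd l := by
    apply IsFractionRing.injective (MvPowerSeries (Fin r) ℝ) (HatFun r)
    rw [map_mul, map_mul]
    exact (div_eq_div_iff (hcoe _ hq) (hcoe _ hq')).mp (hF.symm.trans hF')
  have hl1 := formProd_isHomogeneous l
  have hl2 := formProd_isHomogeneous l'
  have toRat0 : toRat (0 : MvPolynomial (Fin r) ℝ) = 0 := map_zero _
  split_ifs with h h' h'
  · rw [div_eq_div_iff (hrat _ hq) (hrat _ hq')]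
    simp only [toRat, ← map_mul]
    rw [← homPoly_mul P hl2, ← homPoly_mul P' hl1, hPP]
    congr 2
    omega
  · have h1 := homPoly_mul (d := Multiset.card l - r) P hl2
    rw [hPP, homPoly_mul_eq_zero (by omega) P' hl1] at h1
    rw [(mul_eq_zero.mp h1.symm).resolve_right hq', toRat0, zero_div]
  · have h1 := homPoly_mul (d := Multiset.card l' - r) P' hl1
    rw [← hPP, homPoly_mul_eq_zero (by omega) P hl2] at h1
    rw [(mul_eq_zero.mp h1.symm).resolve_right hq, toRat0, zero_div]
  · rfl

theorem toHat_formProd_map {r N : ℕ} (Φ : Fin N → Fin (r + 1) → ℝ) :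
    toHat (formProd (Finset.univ.val.map Φ) : MvPowerSeries (Fin r) ℝ) =
      ∏ k, toHat (linForm (Φ k) : MvPowerSeries (Fin r) ℝ) := by
  have h : formProd (Finset.univ.val.map Φ) = ∏ k, linForm (Φ k) := by
    rw [formProd, Multiset.map_map]
    rfl
  rw [h, ← MvPolynomial.coeToMvPowerSeries.ringHom_apply, map_prod, toHat, map_prod]
  rfl

theorem jFun_mem {r N : ℕ} {Δ : Set (Fin (r + 1) → ℝ)} {Φ : Fin N → Fin (r + 1) → ℝ}
    (hΦ : ∀ k, Φ k ∈ Δ) (a : Fin r → ℝ) : jFun Φ a ∈ hatRing Δ := by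
  refine ⟨expForm (bold a), Finset.univ.val.map Φ, ?_, ?_⟩
  · intro α hα
    obtain ⟨k, -, rfl⟩ := Multiset.mem_map.mp hα
    exact hΦ k
  · rw [toHat_formProd_map, jFun]

theorem one_sub_expForm_neg {r : ℕ} (α : Fin (r + 1) → ℝ) :
    ∃ u : MvPowerSeries (Fin r) ℝ, IsUnit u ∧
      1 - expForm (-α) = (linForm α : MvPowerSeries (Fin r) ℝ) * u := by
  have hneg : linForm (-α) = -linForm α := by simp [linForm]
  have hc : MvPowerSeries.constantCoeff
      ((linForm (-α) : MvPolynomial (Fin r) ℝ) : MvPowerSeries (Fin r) ℝ) = 0 := by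
    rw [← MvPowerSeries.coeff_zero_eq_constantCoeff_apply, MvPolynomial.coeff_coe,
      ← MvPolynomial.constantCoeff_eq]
    simp [linForm]
  have hs := PowerSeries.HasSubst.of_constantCoeff_zero hc
  obtain ⟨v, hv⟩ : (PowerSeries.X : PowerSeries ℝ) ∣ PowerSeries.exp ℝ - 1 := by
    rw [PowerSeries.X_dvd_iff]
    simp
  have hv0 : PowerSeries.constantCoeff v = 1 := by
    have h1 := congrArg (PowerSeries.coeff 1) hv
    rw [← PowerSeries.coeff_zero_eq_constantCoeff_apply]
    have h2 := PowerSeries.coeff_succ_X_mul 0 v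
    rw [zero_add] at h2
    rw [h2] at h1
    rw [← h1]
    simp [PowerSeries.coeff_one, PowerSeries.coeff_exp]
  refine ⟨v.subst (linForm (-α) : MvPowerSeries (Fin r) ℝ), ?_, ?_⟩
  · obtain ⟨w, hw⟩ := (PowerSeries.isUnit_iff_constantCoeff.mpr (by rw [hv0]; exact isUnit_one) :
      IsUnit v)
    rw [← PowerSeries.coe_substAlgHom hs, ← hw]
    exact (w.isUnit).map _
  · have h1 : PowerSeries.exp ℝ = 1 + PowerSeries.X * v := by rw [← hv]; ring
    rw [expForm, h1, ← PowerSeries.coe_substAlgHom hs, map_add, map_mul, map_one,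
      PowerSeries.substAlgHom_X]
    have h2 : ((linForm (-α) : MvPolynomial (Fin r) ℝ) : MvPowerSeries (Fin r) ℝ) =
        -(linForm α : MvPowerSeries (Fin r) ℝ) := by
      rw [hneg, ← MvPolynomial.coeToMvPowerSeries.ringHom_apply, map_neg,
        MvPolynomial.coeToMvPowerSeries.ringHom_apply]
    linear_combination -(PowerSeries.substAlgHom hs v) * h2

theorem kFun_mem {r N : ℕ} {Δ : Set (Fin (r + 1) → ℝ)} {Φ : Fin N → Fin (r + 1) → ℝ}
    (hΦ : ∀ k, Φ k ∈ Δ) (a : Fin r → ℝ) : kFun Φ a ∈ hatRing Δ := by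
  choose u hu h using fun k => one_sub_expForm_neg (Φ k)
  choose w hw using hu
  refine ⟨expForm (bold a) * ∏ k, ((w k)⁻¹ : (MvPowerSeries (Fin r) ℝ)ˣ).val,
    Finset.univ.val.map Φ, ?_, ?_⟩
  · intro α hα
    obtain ⟨k, -, rfl⟩ := Multiset.mem_map.mp hα
    exact hΦ k
  · rw [toHat_formProd_map, kFun]
    have h1 : ∀ k, toHat (1 - expForm (-Φ k)) =
        toHat (linForm (Φ k) : MvPowerSeries (Fin r) ℝ) * toHat (u k) := by
      intro k
      rw [h k]
      exact map_mul _ _ _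
    have h2 : ∀ k, toHat ((w k)⁻¹ : (MvPowerSeries (Fin r) ℝ)ˣ).val = (toHat (u k))⁻¹ := by
      intro k
      refine eq_inv_of_mul_eq_one_left ?_
      rw [← hw k, toHat, toHat, ← map_mul, Units.inv_mul, map_one]
    have h3 : toHat (expForm (bold a) * ∏ k, ((w k)⁻¹ : (MvPowerSeries (Fin r) ℝ)ˣ).val) =
        toHat (expForm (bold a)) * ∏ k, (toHat (u k))⁻¹ := by
      rw [← Finset.prod_congr rfl fun k _ => h2 k]
      simp only [toHat, map_mul, map_prod]
    rw [h3, Finset.prod_congr rfl fun k _ => h1 k, Finset.prod_mul_distrib,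
      Finset.prod_inv_distrib]
    rw [div_eq_mul_inv, div_eq_mul_inv, mul_inv]
    ring

end

end TotalRes

namespace TotalRes

noncomputable section

/-! ### Partial derivatives of rational functions -/

/-! That S_Δ and ∂(V)R_Δ together fill R_Δ is a matter of partial fractions. A linear relation among
the forms of a denominator trades one factor for another until the remaining forms are independent
(`mem_of_forall_linearIndepOn`). Completing them to a basis of E_r gives Laurent monomials in r
independent forms. Such a monomial is a derivative in a dual direction as soon as one exponent
differs from -1, and otherwise it is some f_σ (`laurent_mem`).

The sum is direct because of residues along trees. The identity 1/(AB) = 1/(A(B-A)) - 1/((B-A)B)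
rewrites every f_σ in terms of the fractions ∏_j 1/(x_j - x_{q(j)}) with q(j) > j
(`prod_inv_mem_forestSpan`). For each parent function p, expand in iterated Laurent series in y_j =
x_j - x_{p(j)} and take the coefficient of 1/(y_1⋯y_r). This residue kills derivatives, is 1 on the
fraction of p, and is 0 on the fraction of every other tree (`iterRes_treeFrac_of_ne`). Hence a
combination of tree fractions lying in ∂(V)R_Δ has zero coefficients.

The formula for J is the multinomial theorem applied to ⟨a,x⟩^{N-r}/(N-r)!. For K, substitute Y_j =
ε(e^{εx_j} - 1) with ε = ±1 and Y_{r+1} = 0. Then Y_p - Y_q is an exponential times 1 - e^{-(x_p -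
x_q)}, and the Jacobian is e^{ε∑x_j}. So the integrand of K becomes ∏_j e^{c_j x_j} times the
Jacobian, divided by ∏(Y_p - Y_q), where c_j - a_j is t_j for ε = 1 and s_j for ε = -1. The
expansion e^{c_j x_j} = (1 + εY_j)^{c_j/ε} produces ordinary or rising binomial coefficients.

What remains is that the total residue does not see the substitution (`fracRes_pullback`). By
Euler's formula a homogeneous G/Q of degree other than -r is a divergence, and divergences pull back
to divergences. In degree -r only the leading term of the pullback counts. A pullback of larger
degree has no component of degree -r. -/

theorem toRat_eq_zero {r : ℕ} {p : MvPolynomial (Fin r) ℝ} : toRat p = 0 ↔ p = 0 :=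
  map_eq_zero_iff _ (IsFractionRing.injective (MvPolynomial (Fin r) ℝ) (RatFun r))

theorem toRat_mul {r : ℕ} (p q : MvPolynomial (Fin r) ℝ) : toRat (p * q) = toRat p * toRat q :=
  map_mul _ _ _

theorem toRat_add {r : ℕ} (p q : MvPolynomial (Fin r) ℝ) : toRat (p + q) = toRat p + toRat q :=
  map_add _ _ _

theorem toRat_sub {r : ℕ} (p q : MvPolynomial (Fin r) ℝ) : toRat (p - q) = toRat p - toRat q :=
  map_sub _ _ _

theorem toRat_one {r : ℕ} : toRat (1 : MvPolynomial (Fin r) ℝ) = 1 := map_one _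

theorem toRat_zero {r : ℕ} : toRat (0 : MvPolynomial (Fin r) ℝ) = 0 := map_zero _

theorem toRat_smul {r : ℕ} (c : ℝ) (p : MvPolynomial (Fin r) ℝ) : toRat (c • p) = c • toRat p := by
  simp only [toRat, Algebra.smul_def, map_mul]
  rw [← IsScalarTower.algebraMap_apply]

theorem toRat_C_mul {r : ℕ} (c : ℝ) (p : MvPolynomial (Fin r) ℝ) :
    toRat (MvPolynomial.C c * p) = c • toRat p := by
  rw [← MvPolynomial.smul_eq_C_mul, toRat_smul]

theorem toRat_sum {r : ℕ} {ι : Type*} (s : Finset ι) (f : ι → MvPolynomial (Fin r) ℝ) :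
    toRat (∑ i ∈ s, f i) = ∑ i ∈ s, toRat (f i) := map_sum _ _ _

theorem toRat_prod {r : ℕ} {ι : Type*} (s : Finset ι) (f : ι → MvPolynomial (Fin r) ℝ) :
    toRat (∏ i ∈ s, f i) = ∏ i ∈ s, toRat (f i) := map_prod _ _ _

/-- The homomorphism `P ↦ P + ε ∂_k P` to the dual numbers. -/
def polyDual {r : ℕ} (k : Fin r) : MvPolynomial (Fin r) ℝ →ₐ[ℝ] DualNumber (RatFun r) :=
  MvPolynomial.aeval fun i =>
    TrivSqZeroExt.inl (toRat (MvPolynomial.X i)) + TrivSqZeroExt.inr (if i = k then 1 else 0)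

theorem polyDual_eq {r : ℕ} (k : Fin r) (p : MvPolynomial (Fin r) ℝ) :
    polyDual k p = TrivSqZeroExt.inl (toRat p) +
      TrivSqZeroExt.inr (toRat (MvPolynomial.pderiv k p)) := by
  induction p using MvPolynomial.induction_on with
  | C a =>
    have h : toRat (MvPolynomial.C a) = algebraMap ℝ (RatFun r) a := by
      rw [toRat, ← MvPolynomial.algebraMap_eq, ← IsScalarTower.algebraMap_apply]
    rw [h, polyDual, MvPolynomial.aeval_C, MvPolynomial.pderiv_C, toRat_zero,
      TrivSqZeroExt.inr_zero, add_zero]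
    rfl
  | add p q hp hq =>
    rw [map_add, hp, hq, map_add, toRat_add, toRat_add, TrivSqZeroExt.inl_add,
      TrivSqZeroExt.inr_add]
    abel
  | mul_X p i hp =>
    rw [map_mul, hp, polyDual, MvPolynomial.aeval_X, MvPolynomial.pderiv_mul,
      MvPolynomial.pderiv_X, toRat_mul, toRat_add, toRat_mul, toRat_mul]
    ext
    · by_cases h : i = k <;> simp [h]
    · by_cases h : i = k
      · subst h
        simp [toRat_one]
        ring
      · simp [h, toRat_zero, mul_comm]

/-- A dual number over a field is invertible once its first component is nonzero. This lets P ↦ P +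
ε ∂_k P extend to fractions, so the quotient rule need not be checked for independence of the
representative. -/
theorem isUnit_polyDual {r : ℕ} (k : Fin r)
    (p : nonZeroDivisors (MvPolynomial (Fin r) ℝ)) : IsUnit (polyDual k (p : MvPolynomial _ ℝ)) := by
  rw [TrivSqZeroExt.isUnit_iff_isUnit_fst, polyDual_eq]
  simp only [TrivSqZeroExt.fst_add, TrivSqZeroExt.fst_inl, TrivSqZeroExt.fst_inr, add_zero]
  exact isUnit_iff_ne_zero.mpr (toRat_eq_zero.not.mpr (nonZeroDivisors.ne_zero p.2))

/-- The homomorphism `f ↦ f + ε ∂_k f` to the dual numbers. -/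
def ratDual {r : ℕ} (k : Fin r) : RatFun r →ₐ[ℝ] DualNumber (RatFun r) :=
  IsLocalization.liftAlgHom (M := nonZeroDivisors (MvPolynomial (Fin r) ℝ)) (f := polyDual k)
    (isUnit_polyDual k)

theorem ratDual_toRat {r : ℕ} (k : Fin r) (p : MvPolynomial (Fin r) ℝ) :
    ratDual k (toRat p) = TrivSqZeroExt.inl (toRat p) +
      TrivSqZeroExt.inr (toRat (MvPolynomial.pderiv k p)) := by
  rw [← polyDual_eq, ratDual, toRat, IsLocalization.liftAlgHom_apply, IsLocalization.lift_eq]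
  rfl

theorem exists_toRat_div {r : ℕ} (f : RatFun r) :
    ∃ p q : MvPolynomial (Fin r) ℝ, q ≠ 0 ∧ f = toRat p / toRat q := by
  obtain ⟨p, q, hq, rfl⟩ := IsFractionRing.div_surjective (A := MvPolynomial (Fin r) ℝ) f
  exact ⟨p, q, nonZeroDivisors.ne_zero hq, rfl⟩

theorem fst_ratDual {r : ℕ} (k : Fin r) (f : RatFun r) : (ratDual k f).fst = f := by
  have h : ∀ p, (ratDual k (toRat p)).fst = toRat p := by
    intro p
    simp [ratDual_toRat]
  obtain ⟨p, q, hq, rfl⟩ := exists_toRat_div f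
  have hq' : toRat q ≠ 0 := toRat_eq_zero.not.mpr hq
  have h1 : ratDual k (toRat p / toRat q) * ratDual k (toRat q) = ratDual k (toRat p) := by
    rw [← map_mul, div_mul_cancel₀ _ hq']
  have h2 := congrArg TrivSqZeroExt.fst h1
  rw [TrivSqZeroExt.fst_mul, h, h] at h2
  rw [eq_div_iff hq', h2]

/-- The partial derivative `∂_{x_k}` on rational functions. -/
def ratDeriv {r : ℕ} (k : Fin r) : Derivation ℝ (RatFun r) (RatFun r) :=
  Derivation.mk' ((TrivSqZeroExt.sndHom (RatFun r) (RatFun r)).restrictScalars ℝ ∘ₗ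
    (ratDual k).toLinearMap) fun f g => by
      simp only [LinearMap.comp_apply, AlgHom.toLinearMap_apply, map_mul,
        LinearMap.restrictScalars_apply, TrivSqZeroExt.sndHom_apply, TrivSqZeroExt.snd_mul,
        fst_ratDual, smul_eq_mul, MulOpposite.smul_eq_mul_unop, MulOpposite.unop_op]
      ring

theorem ratDeriv_toRat {r : ℕ} (k : Fin r) (p : MvPolynomial (Fin r) ℝ) :
    ratDeriv k (toRat p) = toRat (MvPolynomial.pderiv k p) := by
  have h : ratDeriv k (toRat p) = (ratDual k (toRat p)).snd := rfl
  rw [h, ratDual_toRat]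
  simp

theorem ratDeriv_div {r : ℕ} (k : Fin r) (p q : MvPolynomial (Fin r) ℝ) :
    ratDeriv k (toRat p / toRat q) =
      toRat (MvPolynomial.pderiv k p * q - p * MvPolynomial.pderiv k q) / toRat q ^ 2 := by
  rw [Derivation.leibniz_div, ratDeriv_toRat, ratDeriv_toRat, toRat_sub, toRat_mul, toRat_mul,
    smul_eq_mul, smul_eq_mul, smul_eq_mul, div_eq_inv_mul, inv_pow]
  ring

/-! ### The ring `R_Δ` -/

theorem formProd_zero {r : ℕ} : formProd (0 : Multiset (Fin (r + 1) → ℝ)) = 1 := by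
  simp [formProd]

theorem formProd_add {r : ℕ} (l l' : Multiset (Fin (r + 1) → ℝ)) :
    formProd (l + l') = formProd l * formProd l' := by
  simp [formProd]

theorem formProd_singleton {r : ℕ} (α : Fin (r + 1) → ℝ) : formProd {α} = linForm α := by
  simp [formProd]

theorem toRat_mem_ratRing {r : ℕ} (Δ : Set (Fin (r + 1) → ℝ)) (p : MvPolynomial (Fin r) ℝ) :
    toRat p ∈ ratRing Δ :=
  Algebra.subset_adjoin (Or.inl ⟨p, rfl⟩)

theorem inv_linForm_mem_ratRing {r : ℕ} {Δ : Set (Fin (r + 1) → ℝ)} {α : Fin (r + 1) → ℝ}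
    (hα : α ∈ Δ) : (toRat (linForm α))⁻¹ ∈ ratRing Δ :=
  Algebra.subset_adjoin (Or.inr ⟨α, hα, rfl⟩)

theorem inv_formProd_mem_ratRing {r : ℕ} {Δ : Set (Fin (r + 1) → ℝ)}
    {l : Multiset (Fin (r + 1) → ℝ)} (hl : ∀ α ∈ l, α ∈ Δ) :
    (toRat (formProd l))⁻¹ ∈ ratRing Δ := by
  induction l using Multiset.induction_on with
  | empty => simp [formProd_zero, toRat_one]
  | cons α l ih =>
    rw [← Multiset.singleton_add, formProd_add, formProd_singleton, toRat_mul, mul_inv]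
    exact mul_mem (inv_linForm_mem_ratRing (hl _ (Multiset.mem_cons_self _ _)))
      (ih fun β hβ => hl β (Multiset.mem_cons_of_mem hβ))

theorem div_formProd_mem_ratRing {r : ℕ} {Δ : Set (Fin (r + 1) → ℝ)}
    {l : Multiset (Fin (r + 1) → ℝ)} (hl : ∀ α ∈ l, α ∈ Δ) (p : MvPolynomial (Fin r) ℝ) :
    toRat p / toRat (formProd l) ∈ ratRing Δ := by
  rw [div_eq_mul_inv]
  exact mul_mem (toRat_mem_ratRing Δ p) (inv_formProd_mem_ratRing hl)

theorem formProd_ne_zero' {r : ℕ} {Δ : Set (Fin (r + 1) → ℝ)} (h0 : ∀ α ∈ Δ, linForm α ≠ 0)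
    {l : Multiset (Fin (r + 1) → ℝ)} (hl : ∀ α ∈ l, α ∈ Δ) : formProd l ≠ 0 := by
  rw [formProd, Ne, Multiset.prod_eq_zero_iff, Multiset.mem_map]
  rintro ⟨α, hα, h⟩
  exact h0 α (hl α hα) h

/-- Since the forms in Δ are nonzero, sums can be put over a common denominator. This links the
subring given by generators to the explicit fractions that define `derivSpace`. -/
theorem exists_eq_div_formProd {r : ℕ} {Δ : Set (Fin (r + 1) → ℝ)}
    (h0 : ∀ α ∈ Δ, linForm α ≠ 0) {f : RatFun r} (hf : f ∈ ratRing Δ) :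
    ∃ (p : MvPolynomial (Fin r) ℝ) (l : Multiset (Fin (r + 1) → ℝ)),
      (∀ α ∈ l, α ∈ Δ) ∧ f = toRat p / toRat (formProd l) := by
  induction hf using Algebra.adjoin_induction with
  | mem f hf =>
    rcases hf with ⟨p, rfl⟩ | ⟨α, hα, rfl⟩
    · exact ⟨p, 0, by simp, by simp [formProd_zero, toRat_one]⟩
    · exact ⟨1, {α}, by simpa using hα, by simp [formProd_singleton, toRat_one]⟩
  | algebraMap c =>
    refine ⟨algebraMap _ _ c, 0, by simp, ?_⟩
    rw [formProd_zero, toRat_one, div_one, toRat, ← IsScalarTower.algebraMap_apply]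
  | add f g _ _ hf hg =>
    obtain ⟨p, l, hl, rfl⟩ := hf
    obtain ⟨p', l', hl', rfl⟩ := hg
    refine ⟨p * formProd l' + formProd l * p', l + l', ?_, ?_⟩
    · intro α hα
      exact (Multiset.mem_add.mp hα).elim (hl α) (hl' α)
    · rw [formProd_add, toRat_add, toRat_mul, toRat_mul, toRat_mul, div_add_div]
      · exact toRat_eq_zero.not.mpr (formProd_ne_zero' h0 hl)
      · exact toRat_eq_zero.not.mpr (formProd_ne_zero' h0 hl')
  | mul f g _ _ hf hg =>
    obtain ⟨p, l, hl, rfl⟩ := hf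
    obtain ⟨p', l', hl', rfl⟩ := hg
    refine ⟨p * p', l + l', ?_, ?_⟩
    · intro α hα
      exact (Multiset.mem_add.mp hα).elim (hl α) (hl' α)
    · rw [formProd_add, toRat_mul, toRat_mul, div_mul_div_comm]

theorem ratDeriv_div_mem_derivSpace {r : ℕ} {Δ : Set (Fin (r + 1) → ℝ)} (k : Fin r)
    (p : MvPolynomial (Fin r) ℝ) {l : Multiset (Fin (r + 1) → ℝ)} (hl : ∀ α ∈ l, α ∈ Δ) :
    ratDeriv k (toRat p / toRat (formProd l)) ∈ derivSpace Δ :=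
  Submodule.subset_span ⟨k, p, l, hl, ratDeriv_div k p _⟩

theorem ratDeriv_mem_derivSpace {r : ℕ} {Δ : Set (Fin (r + 1) → ℝ)}
    (h0 : ∀ α ∈ Δ, linForm α ≠ 0) (k : Fin r) {f : RatFun r} (hf : f ∈ ratRing Δ) :
    ratDeriv k f ∈ derivSpace Δ := by
  obtain ⟨p, l, hl, rfl⟩ := exists_eq_div_formProd h0 hf
  exact ratDeriv_div_mem_derivSpace k p hl

theorem derivSpace_le_ratRing {r : ℕ} (Δ : Set (Fin (r + 1) → ℝ)) :
    derivSpace Δ ≤ Subalgebra.toSubmodule (ratRing Δ) := by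
  refine Submodule.span_le.mpr ?_
  rintro _ ⟨k, p, l, hl, rfl⟩
  rw [div_eq_mul_inv, ← inv_pow]
  exact (ratRing Δ).mul_mem (toRat_mem_ratRing Δ _) (pow_mem (inv_formProd_mem_ratRing hl) 2)

theorem simpleSpace_le_ratRing {r : ℕ} (Δ : Set (Fin (r + 1) → ℝ)) :
    simpleSpace Δ ≤ Subalgebra.toSubmodule (ratRing Δ) := by
  refine Submodule.span_le.mpr ?_
  rintro _ ⟨σ, hσ, rfl⟩
  rw [← Finset.prod_inv_distrib]
  exact (ratRing Δ).prod_mem fun α hα => inv_linForm_mem_ratRing (hσ.1 hα)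

end

/-! ### Existence of the decomposition -/

noncomputable section

/-! ### Linear forms -/

/-- `linForm` as a linear map. -/
def linFormHom (r : ℕ) : (Fin (r + 1) → ℝ) →ₗ[ℝ] MvPolynomial (Fin r) ℝ where
  toFun := linForm
  map_add' a b := by simp [linForm, add_mul, Finset.sum_add_distrib]
  map_smul' c a := by
    simp [linForm, MvPolynomial.smul_eq_C_mul, Finset.mul_sum, mul_assoc]

theorem linFormHom_apply {r : ℕ} (a : Fin (r + 1) → ℝ) : linFormHom r a = linForm a := rfl

/-- The linear forms as rational functions. -/
def ratForm (r : ℕ) : (Fin (r + 1) → ℝ) →ₗ[ℝ] RatFun r where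
  toFun a := toRat (linForm a)
  map_add' a b := by
    rw [← linFormHom_apply, map_add, toRat_add]
    rfl
  map_smul' c a := by
    rw [← linFormHom_apply, map_smul, toRat_smul]
    rfl

theorem ratForm_apply {r : ℕ} (a : Fin (r + 1) → ℝ) : ratForm r a = toRat (linForm a) := rfl

theorem linForm_root_last {r : ℕ} (k : Fin r) :
    linForm (root k.castSucc (Fin.last r)) = MvPolynomial.X k := by
  simp [linForm, root, Pi.single_apply, ite_mul, Fin.castSucc_ne_last]

theorem root_mem_rootSpace {r : ℕ} (i j : Fin (r + 1)) : root i j ∈ rootSpace r := by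
  change ∑ k, root i j k = 0
  simp [root, Finset.sum_sub_distrib]

theorem eq_sum_root_last {r : ℕ} {β : Fin (r + 1) → ℝ} (hβ : β ∈ rootSpace r) :
    β = ∑ k : Fin r, β k.castSucc • root k.castSucc (Fin.last r) := by
  have h : ∑ i, β i = 0 := hβ
  rw [Fin.sum_univ_castSucc] at h
  funext i
  refine Fin.lastCases ?_ (fun i => ?_) i
  · simp [root, (Fin.castSucc_ne_last _).symm]
    linarith
  · simp [root, Pi.single_apply, Fin.castSucc_ne_last, Fin.castSucc_inj]

theorem pderiv_linForm {r : ℕ} (k : Fin r) (a : Fin (r + 1) → ℝ) :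
    MvPolynomial.pderiv k (linForm a) = MvPolynomial.C (a k.castSucc) := by
  simp [linForm, MvPolynomial.pderiv_X, Pi.single_apply]

theorem exists_dual_vector {r : ℕ} {τ : Set (Fin (r + 1) → ℝ)} (hτ : LinearIndepOn ℝ id τ)
    (hτE : τ ⊆ rootSpace r) {β₀ : Fin (r + 1) → ℝ} (hβ₀ : β₀ ∈ τ) :
    ∃ v : Fin r → ℝ, ∑ k, v k * β₀ k.castSucc = 1 ∧
      ∀ β ∈ τ, β ≠ β₀ → ∑ k, v k * β k.castSucc = 0 := by
  classical
  -- Completing τ to a basis of all of ℝ^{r+1} provides a coordinate functional dual to β₀. On E_r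
  -- it is determined by its values on the roots e^k - e^{r+1}, and these are the entries of v.
  let b := Module.Basis.extend hτ
  have hsub := hτ.subset_extend (Set.subset_univ τ)
  have key : ∀ β (hβ : β ∈ τ), ∑ k : Fin r, b.coord ⟨β₀, hsub hβ₀⟩ (root k.castSucc (Fin.last r)) *
      β k.castSucc = if β = β₀ then 1 else 0 := by
    intro β hβ
    have h1 : b.coord ⟨β₀, hsub hβ₀⟩ β = if β = β₀ then 1 else 0 := by
      have h2 : β = b ⟨β, hsub hβ⟩ := (Module.Basis.extend_apply_self hτ ⟨β, hsub hβ⟩).symm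
      conv_lhs => rw [h2]
      rw [Module.Basis.coord_apply, Module.Basis.repr_self, Finsupp.single_apply]
      simp
    rw [← h1]
    conv_rhs => rw [eq_sum_root_last (hτE hβ)]
    simp [mul_comm]
  refine ⟨_, (key β₀ hβ₀).trans (if_pos rfl), fun β hβ hne => (key β hβ).trans (if_neg hne)⟩

/-! ### Partial fractions -/

/-- A subspace contains the fractions `q / ∏ ℓ(β)^{n_β}` as soon as it contains those whose
denominator involves linearly independent `β`. -/
theorem mem_of_forall_linearIndepOn {E K : Type*} [AddCommGroup E] [Module ℝ E] [Field K]
    [Algebra ℝ K] (ℓ : E →ₗ[ℝ] K) (q : K) (B : Submodule ℝ K) {Δ : Set E}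
    (h0 : ∀ α ∈ Δ, ℓ α ≠ 0)
    (H : ∀ T : Finset E, (T : Set E) ⊆ Δ → LinearIndepOn ℝ id (T : Set E) → ∀ n : E → ℕ,
      q * ∏ β ∈ T, (ℓ β)⁻¹ ^ n β ∈ B)
    (T : Finset E) (hT : (T : Set E) ⊆ Δ) (n : E → ℕ) : q * ∏ β ∈ T, (ℓ β)⁻¹ ^ n β ∈ B := by
  classical
  induction hc : T.card using Nat.strong_induction_on generalizing T n with
  | _ c ih =>
  by_cases hind : LinearIndepOn ℝ id (T : Set E)
  · exact H T hT hind n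
  obtain ⟨g, hg, β₀, hβ₀, hgβ₀⟩ : ∃ g : E → ℝ, ∑ β ∈ T, g β • β = 0 ∧ ∃ β₀ ∈ T, g β₀ ≠ 0 := by
    rw [linearIndepOn_finset_iff] at hind
    push Not at hind
    simpa using hind
  have hrel : ∑ β ∈ T.erase β₀, (-(g β / g β₀)) • ℓ β = ℓ β₀ := by
    have h1 := congrArg ℓ hg
    rw [← Finset.add_sum_erase _ _ hβ₀, map_add, map_sum, map_zero] at h1
    simp only [map_smul] at h1
    have h2 : ∑ β ∈ T.erase β₀, g β • ℓ β = -(g β₀ • ℓ β₀) := by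
      rw [eq_neg_iff_add_eq_zero, add_comm, h1]
    have h3 : ∀ β, (-(g β / g β₀)) • ℓ β = (-(g β₀)⁻¹) • (g β • ℓ β) := by
      intro β
      rw [smul_smul]
      congr 1
      ring
    rw [Finset.sum_congr rfl fun β _ => h3 β, ← Finset.smul_sum, h2, smul_neg, neg_smul, neg_neg,
      smul_smul, inv_mul_cancel₀ hgβ₀, one_smul]
  have hℓ₀ := h0 β₀ (hT hβ₀)
  -- The form β₀ stays fixed from here on. The total exponent of the other forms decreases until one
  -- of them leaves the denominator, and then the induction on the size of T applies.
  induction hN : ∑ β ∈ T.erase β₀, n β using Nat.strong_induction_on generalizing n with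
  | _ N ihN =>
  by_cases hz : ∃ β ∈ T.erase β₀, n β = 0
  · obtain ⟨β, hβ, hn⟩ := hz
    rw [← Finset.prod_erase T (a := β) (by simp [hn])]
    exact ih _ (hc ▸ Finset.card_erase_lt_of_mem (Finset.mem_of_mem_erase hβ)) _
      (fun x hx => hT (Finset.mem_of_mem_erase hx)) n rfl
  push Not at hz
  -- Multiply by 1 = (∑ c_β ℓ(β)) / ℓ(β₀). Each term gains a factor 1/ℓ(β₀) and loses one factor
  -- 1/ℓ(β).
  have hprod : q * ∏ β ∈ T, (ℓ β)⁻¹ ^ n β = ∑ β ∈ T.erase β₀, (-(g β / g β₀)) •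
      (q * ((∏ β ∈ T, (ℓ β)⁻¹ ^ n β) * ℓ β * (ℓ β₀)⁻¹)) := by
    have h1 : ∀ β, (-(g β / g β₀)) • (q * ((∏ β ∈ T, (ℓ β)⁻¹ ^ n β) * ℓ β * (ℓ β₀)⁻¹)) =
        q * (∏ β ∈ T, (ℓ β)⁻¹ ^ n β) * (ℓ β₀)⁻¹ * ((-(g β / g β₀)) • ℓ β) := by
      intro β
      rw [mul_smul_comm]
      congr 1
      ring
    rw [Finset.sum_congr rfl fun β _ => h1 β, ← Finset.mul_sum, hrel,
      inv_mul_cancel_right₀ hℓ₀]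
  rw [hprod]
  refine Submodule.sum_mem _ fun β hβ => Submodule.smul_mem _ _ ?_
  have hβT := Finset.mem_of_mem_erase hβ
  have hne : β ≠ β₀ := Finset.ne_of_mem_erase hβ
  have hβ₀' : β₀ ∈ T.erase β := Finset.mem_erase.mpr ⟨hne.symm, hβ₀⟩
  let n' : E → ℕ := Function.update (Function.update n β₀ (n β₀ + 1)) β (n β - 1)
  have hn'β : n' β = n β - 1 := Function.update_self ..
  have hn'β₀ : n' β₀ = n β₀ + 1 := by
    rw [show n' β₀ = _ from Function.update_of_ne hne.symm .., Function.update_self]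
  have hn' : ∀ x, x ≠ β → x ≠ β₀ → n' x = n x := fun x h1 h2 => by
    rw [show n' x = _ from Function.update_of_ne h1 .., Function.update_of_ne h2]
  have hterm : (∏ β ∈ T, (ℓ β)⁻¹ ^ n β) * ℓ β * (ℓ β₀)⁻¹ = ∏ β ∈ T, (ℓ β)⁻¹ ^ n' β := by
    have hrest : ∏ x ∈ (T.erase β).erase β₀, (ℓ x)⁻¹ ^ n x =
        ∏ x ∈ (T.erase β).erase β₀, (ℓ x)⁻¹ ^ n' x := by
      refine Finset.prod_congr rfl fun x hx => ?_
      rw [hn' x (Finset.ne_of_mem_erase (Finset.mem_of_mem_erase hx)) (Finset.ne_of_mem_erase hx)]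
    rw [← Finset.mul_prod_erase T _ hβT, ← Finset.mul_prod_erase T (fun x => (ℓ x)⁻¹ ^ n' x) hβT,
      ← Finset.mul_prod_erase _ _ hβ₀', ← Finset.mul_prod_erase _ (fun x => (ℓ x)⁻¹ ^ n' x) hβ₀',
      hrest, hn'β, hn'β₀, pow_succ]
    obtain ⟨m, hm⟩ := Nat.exists_eq_succ_of_ne_zero (hz β hβ)
    have h3 : (ℓ β)⁻¹ ^ n β * ℓ β = (ℓ β)⁻¹ ^ (n β - 1) := by
      rw [hm, Nat.succ_sub_one, Nat.succ_eq_add_one, pow_succ,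
        inv_mul_cancel_right₀ (h0 β (hT hβT))]
    rw [← h3]
    ring
  rw [hterm]
  refine ihN (∑ x ∈ T.erase β₀, n' x) ?_ n' rfl
  rw [← hN]
  refine Finset.sum_lt_sum (fun x hx => ?_) ⟨β, hβ, ?_⟩
  · by_cases hx' : x = β
    · rw [hx', hn'β]
      exact Nat.sub_le _ _
    · rw [hn' x hx' (Finset.ne_of_mem_erase hx)]
  · rw [hn'β]
    have := hz β hβ
    omega

/-! ### The decomposition `R_Δ = S_Δ + ∂(V) R_Δ` -/

theorem derivation_prod_eq_zero {ι K : Type*} [Field K] [Algebra ℝ K] (D : Derivation ℝ K K)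
    (s : Finset ι) (f : ι → K) (h : ∀ i ∈ s, D (f i) = 0) : D (∏ i ∈ s, f i) = 0 := by
  classical
  induction s using Finset.induction_on with
  | empty => simp
  | insert i s hi ih =>
    rw [Finset.prod_insert hi, Derivation.leibniz, h i (Finset.mem_insert_self i s),
      ih fun j hj => h j (Finset.mem_insert_of_mem hj), smul_zero, smul_zero, add_zero]

theorem derivation_zpow {K : Type*} [Field K] [Algebra ℝ K] (D : Derivation ℝ K K) (a : K) (z : ℤ) :
    D (a ^ z) = (z : ℝ) • (a ^ (z - 1) * D a) := by
  rw [Derivation.leibniz_zpow, smul_eq_mul, Int.cast_smul_eq_zsmul]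

theorem derivation_sum_apply {ι K : Type*} [Field K] [Algebra ℝ K] (s : Finset ι)
    (D : ι → Derivation ℝ K K) (a : K) : (∑ i ∈ s, D i) a = ∑ i ∈ s, D i a := by
  classical
  induction s using Finset.induction_on with
  | empty => simp
  | insert i s hi ih => rw [Finset.sum_insert hi, Finset.sum_insert hi, Derivation.add_apply, ih]

theorem ratForm_zpow_mem_ratRing {r : ℕ} {Δ : Set (Fin (r + 1) → ℝ)} {β : Fin (r + 1) → ℝ}
    (hβ : β ∈ Δ) (z : ℤ) : ratForm r β ^ z ∈ ratRing Δ := by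
  obtain ⟨n, rfl | rfl⟩ := z.eq_nat_or_neg
  · rw [zpow_natCast]
    exact pow_mem (toRat_mem_ratRing Δ _) n
  · rw [zpow_neg, zpow_natCast, ← inv_pow]
    exact pow_mem (inv_linForm_mem_ratRing hβ) n

theorem IsBasisOf.subset_rootSpace {r : ℕ} {Δ : Set (Fin (r + 1) → ℝ)}
    {τ : Finset (Fin (r + 1) → ℝ)} (hτ : IsBasisOf Δ τ) :
    (τ : Set (Fin (r + 1) → ℝ)) ⊆ rootSpace r := by
  rw [← hτ.2.2]
  exact Submodule.subset_span

/-- With v dual to β₀ inside τ, the derivation ∑ v_k ∂_k sends the form β₀ to 1 and kills the other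
forms of τ. It therefore acts on Laurent monomials in τ as differentiation in the single variable
β₀, where z^n has a primitive exactly when n ≠ -1. -/
theorem laurent_mem {r : ℕ} {Δ : Set (Fin (r + 1) → ℝ)} (h0 : ∀ α ∈ Δ, linForm α ≠ 0)
    {τ : Finset (Fin (r + 1) → ℝ)} (hτ : IsBasisOf Δ τ) (z : (Fin (r + 1) → ℝ) → ℤ) :
    ∏ β ∈ τ, ratForm r β ^ z β ∈ simpleSpace Δ ⊔ derivSpace Δ := by
  classical
  by_cases hz : ∀ β ∈ τ, z β = -1
  · refine Submodule.mem_sup_left (Submodule.subset_span ⟨τ, hτ, ?_⟩)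
    rw [← Finset.prod_inv_distrib]
    refine Finset.prod_congr rfl fun β hβ => ?_
    rw [hz β hβ, zpow_neg_one, ratForm_apply]
  push Not at hz
  obtain ⟨β₀, hβ₀, hz₀⟩ := hz
  refine Submodule.mem_sup_right ?_
  obtain ⟨v, hv1, hv0⟩ := exists_dual_vector hτ.2.1 hτ.subset_rootSpace
    (Finset.mem_coe.mpr hβ₀)
  let D : Derivation ℝ (RatFun r) (RatFun r) := ∑ k, v k • ratDeriv k
  have hD : ∀ f, D f = ∑ k, v k • ratDeriv k f := by
    intro f
    rw [derivation_sum_apply]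
    rfl
  have hDform : ∀ β, D (ratForm r β) = algebraMap ℝ _ (∑ k, v k * β k.castSucc) := by
    intro β
    rw [hD, map_sum]
    refine Finset.sum_congr rfl fun k _ => ?_
    rw [ratForm_apply, ratDeriv_toRat, pderiv_linForm, toRat, ← MvPolynomial.algebraMap_eq,
      ← IsScalarTower.algebraMap_apply, map_mul, Algebra.smul_def]
  have hne : ratForm r β₀ ≠ 0 := toRat_eq_zero.not.mpr (h0 β₀ (hτ.1 hβ₀))
  let g : RatFun r := ratForm r β₀ ^ (z β₀ + 1) * ∏ β ∈ τ.erase β₀, ratForm r β ^ z β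
  have hg : g ∈ ratRing Δ :=
    mul_mem (ratForm_zpow_mem_ratRing (hτ.1 hβ₀) _) (prod_mem fun β hβ =>
      ratForm_zpow_mem_ratRing (hτ.1 (Finset.mem_of_mem_erase hβ)) _)
  have hDg : D g = ((z β₀ + 1 : ℤ) : ℝ) • ∏ β ∈ τ, ratForm r β ^ z β := by
    have h1 : D (∏ β ∈ τ.erase β₀, ratForm r β ^ z β) = 0 := by
      refine derivation_prod_eq_zero D _ _ fun β hβ => ?_
      rw [derivation_zpow, hDform, hv0 β (Finset.mem_of_mem_erase hβ)
        (Finset.ne_of_mem_erase hβ), map_zero, mul_zero, smul_zero]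
    rw [Derivation.leibniz, h1, smul_zero, zero_add, derivation_zpow, hDform, hv1,
      map_one, ← Finset.mul_prod_erase τ _ hβ₀, add_sub_cancel_right, smul_eq_mul,
      mul_one, mul_smul_comm, mul_comm]
  have hmem : D g ∈ derivSpace Δ := by
    rw [hD]
    exact Submodule.sum_mem _ fun k _ => Submodule.smul_mem _ _ (ratDeriv_mem_derivSpace h0 k hg)
  have hc : ((z β₀ + 1 : ℤ) : ℝ) ≠ 0 := by
    rw [Int.cast_ne_zero]
    omega
  rw [hDg] at hmem
  exact (Submodule.smul_mem_iff _ hc).mp hmem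

theorem exists_isBasisOf {r : ℕ} {Δ : Set (Fin (r + 1) → ℝ)}
    (hΔ : Submodule.span ℝ Δ = rootSpace r) {T : Finset (Fin (r + 1) → ℝ)}
    (hT : (T : Set (Fin (r + 1) → ℝ)) ⊆ Δ)
    (hind : LinearIndepOn ℝ id (T : Set (Fin (r + 1) → ℝ))) :
    ∃ τ : Finset (Fin (r + 1) → ℝ), T ⊆ τ ∧ IsBasisOf Δ τ := by
  obtain ⟨b, hbΔ, hTb, hΔb, hb⟩ := exists_linearIndepOn_id_extension hind hT
  have hfin : b.Finite := hb.linearIndependent.setFinite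
  refine ⟨hfin.toFinset, fun x hx => by simpa using hTb hx, by simpa using hbΔ, by simpa using hb,
    ?_⟩
  rw [Set.Finite.coe_toFinset, ← hΔ]
  exact le_antisymm (Submodule.span_mono hbΔ) (Submodule.span_le.mpr hΔb)

/-- As τ spans E_r, each coordinate x_i, being the form of e^i - e^{r+1}, is a combination of
elements of τ. Multiplying by an element of τ shifts one exponent of a Laurent monomial. -/
theorem toRat_mul_mem_span_laurent {r : ℕ} {Δ : Set (Fin (r + 1) → ℝ)}
    (h0 : ∀ α ∈ Δ, linForm α ≠ 0) {τ : Finset (Fin (r + 1) → ℝ)} (hτ : IsBasisOf Δ τ)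
    (p : MvPolynomial (Fin r) ℝ) {f : RatFun r}
    (hf : f ∈ Submodule.span ℝ (Set.range fun z : (Fin (r + 1) → ℝ) → ℤ =>
      ∏ β ∈ τ, ratForm r β ^ z β)) :
    toRat p * f ∈ Submodule.span ℝ (Set.range fun z : (Fin (r + 1) → ℝ) → ℤ =>
      ∏ β ∈ τ, ratForm r β ^ z β) := by
  classical
  induction p using MvPolynomial.induction_on generalizing f with
  | C c =>
    rw [← mul_one (MvPolynomial.C c), toRat_C_mul, toRat_one, smul_mul_assoc, one_mul]
    exact Submodule.smul_mem _ _ hf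
  | add p q hp hq =>
    rw [toRat_add, add_mul]
    exact Submodule.add_mem _ (hp hf) (hq hf)
  | mul_X p i hp =>
    rw [toRat_mul, mul_assoc]
    refine hp ?_
    have hform : ∀ a ∈ Submodule.span ℝ (τ : Set (Fin (r + 1) → ℝ)), ratForm r a * f ∈
        Submodule.span ℝ (Set.range fun z : (Fin (r + 1) → ℝ) → ℤ =>
          ∏ β ∈ τ, ratForm r β ^ z β) := by
      intro a ha
      induction ha using Submodule.span_induction with
      | zero => simp
      | add a b _ _ ha hb =>
        rw [map_add, add_mul]
        exact Submodule.add_mem _ ha hb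
      | smul c a _ ha =>
        rw [map_smul, smul_mul_assoc]
        exact Submodule.smul_mem _ _ ha
      | mem β₀ hβ₀ =>
        have hβ₀' : β₀ ∈ τ := hβ₀
        have hne : ratForm r β₀ ≠ 0 := toRat_eq_zero.not.mpr (h0 β₀ (hτ.1 hβ₀))
        induction hf using Submodule.span_induction with
        | zero => simp
        | add a b _ _ ha hb =>
          rw [mul_add]
          exact Submodule.add_mem _ ha hb
        | smul c a _ ha =>
          rw [mul_smul_comm]
          exact Submodule.smul_mem _ _ ha
        | mem f hf =>
          obtain ⟨z, rfl⟩ := hf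
          refine Submodule.subset_span ⟨Function.update z β₀ (z β₀ + 1), ?_⟩
          simp only
          rw [← Finset.mul_prod_erase τ _ hβ₀', ← Finset.mul_prod_erase τ
            (fun β => ratForm r β ^ z β) hβ₀', Function.update_self, zpow_add_one₀ hne,
            Finset.prod_congr rfl fun β hβ => by
              rw [Function.update_of_ne (Finset.ne_of_mem_erase hβ)]]
          ring
    rw [← linForm_root_last]
    exact hform _ (hτ.2.2 ▸ root_mem_rootSpace _ _)

theorem div_formProd_mem_sup {r : ℕ} {Δ : Set (Fin (r + 1) → ℝ)}
    (h0 : ∀ α ∈ Δ, linForm α ≠ 0) (hΔ : Submodule.span ℝ Δ = rootSpace r)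
    (p : MvPolynomial (Fin r) ℝ) {l : Multiset (Fin (r + 1) → ℝ)} (hl : ∀ α ∈ l, α ∈ Δ) :
    toRat p / toRat (formProd l) ∈ simpleSpace Δ ⊔ derivSpace Δ := by
  classical
  have hprod : toRat p / toRat (formProd l) =
      toRat p * ∏ β ∈ l.toFinset, (ratForm r β)⁻¹ ^ l.count β := by
    rw [div_eq_mul_inv, formProd, Finset.prod_multiset_map_count, toRat_prod,
      ← Finset.prod_inv_distrib]
    congr 1
    refine Finset.prod_congr rfl fun β _ => ?_
    rw [inv_pow, ratForm_apply, toRat, toRat, map_pow]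
  rw [hprod]
  refine mem_of_forall_linearIndepOn (ratForm r) (toRat p) _ (Δ := Δ)
    (fun α hα => toRat_eq_zero.not.mpr (h0 α hα)) (fun T hT hind n => ?_) _
    (fun α hα => hl α (by simpa using hα)) _
  obtain ⟨τ, hTτ, hτ⟩ := exists_isBasisOf hΔ hT hind
  have hle : Submodule.span ℝ (Set.range fun z : (Fin (r + 1) → ℝ) → ℤ =>
      ∏ β ∈ τ, ratForm r β ^ z β) ≤ simpleSpace Δ ⊔ derivSpace Δ := by
    refine Submodule.span_le.mpr ?_
    rintro _ ⟨z, rfl⟩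
    exact laurent_mem h0 hτ z
  refine hle (toRat_mul_mem_span_laurent h0 hτ p (Submodule.subset_span
    ⟨fun β => if β ∈ T then -(n β : ℤ) else 0, ?_⟩))
  simp only
  rw [← Finset.prod_subset hTτ (f := fun β => ratForm r β ^ (if β ∈ T then -(n β : ℤ) else 0))]
  · refine Finset.prod_congr rfl fun β hβ => ?_
    rw [if_pos hβ, zpow_neg, zpow_natCast, inv_pow]
  · intro β _ hβ
    rw [if_neg hβ, zpow_zero]

theorem simpleSpace_sup_derivSpace {r : ℕ} {Δ : Set (Fin (r + 1) → ℝ)}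
    (h0 : ∀ α ∈ Δ, linForm α ≠ 0) (hΔ : Submodule.span ℝ Δ = rootSpace r) :
    simpleSpace Δ ⊔ derivSpace Δ = Subalgebra.toSubmodule (ratRing Δ) := by
  refine le_antisymm (sup_le (simpleSpace_le_ratRing Δ) (derivSpace_le_ratRing Δ)) fun f hf => ?_
  obtain ⟨p, l, hl, rfl⟩ := exists_eq_div_formProd h0 hf
  exact div_formProd_mem_sup h0 hΔ p hl

end

/-! ### Directness of the decomposition: residues along trees -/

noncomputable section

/-! ### Iterated Laurent series -/

/-- Iterated Laurent series in `r` variables `y_1, …, y_r`. -/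
abbrev Iter (r : ℕ) : Type := HahnSeries (Lex (Fin r → ℤ)) ℝ

/-- The exponent of the variable `y_j`. -/
def expo {r : ℕ} (j : Fin r) : Lex (Fin r → ℤ) := toLex (Pi.single j 1)

/-- The derivation `y_j ∂/∂y_j` of the field of iterated Laurent series. -/
def theta {r : ℕ} (j : Fin r) : Derivation ℝ (Iter r) (Iter r) :=
  Derivation.mk'
    { toFun := fun f => ⟨fun m => (ofLex m j : ℝ) * f.coeff m,
        f.isPWO_support.mono fun m hm h => hm (by simp [h])⟩
      map_add' := fun f g => by
        ext m
        simp [mul_add]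
      map_smul' := fun c f => by
        ext m
        simp only [HahnSeries.coeff_smul, smul_eq_mul, RingHom.id_apply]
        ring } fun f g => by
      have hsub : ∀ f : Iter r, (⟨fun m => (ofLex m j : ℝ) * f.coeff m,
          f.isPWO_support.mono fun m hm h => hm (by simp [h])⟩ : Iter r).support ⊆ f.support :=
        fun f m hm h => hm (by simp [h])
      ext m
      simp only [LinearMap.coe_mk, AddHom.coe_mk, smul_eq_mul, HahnSeries.coeff_add]
      rw [HahnSeries.coeff_mul, HahnSeries.coeff_mul_right' g.isPWO_support (hsub g), mul_comm g,
        HahnSeries.coeff_mul_left' f.isPWO_support (hsub f), Finset.mul_sum,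
        ← Finset.sum_add_distrib]
      refine Finset.sum_congr rfl fun x hx => ?_
      have hx' : x.1 + x.2 = m := by
        simp only [Finset.mem_antidiagonal] at hx
        exact hx.2.2
      rw [← hx', ofLex_add, Pi.add_apply]
      push_cast
      ring

theorem coeff_theta {r : ℕ} (j : Fin r) (f : Iter r) (m : Lex (Fin r → ℤ)) :
    (theta j f).coeff m = (ofLex m j : ℝ) * f.coeff m := rfl

/-- The partial derivative `∂/∂y_j` of iterated Laurent series. -/
def iterDeriv {r : ℕ} (j : Fin r) : Derivation ℝ (Iter r) (Iter r) :=
  HahnSeries.single (-expo j) (1 : ℝ) • theta j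

theorem coeff_iterDeriv {r : ℕ} (j : Fin r) (f : Iter r) (m : Lex (Fin r → ℤ)) :
    (iterDeriv j f).coeff m = (ofLex m j + 1 : ℝ) * f.coeff (m + expo j) := by
  rw [iterDeriv, Derivation.smul_apply, smul_eq_mul, HahnSeries.coeff_single_mul, one_mul,
    sub_neg_eq_add, coeff_theta, ofLex_add, Pi.add_apply]
  simp [expo]

theorem iterDeriv_single {r : ℕ} (j k : Fin r) :
    iterDeriv j (HahnSeries.single (expo k) (1 : ℝ)) = if j = k then 1 else 0 := by
  have h : theta j (HahnSeries.single (expo k) (1 : ℝ)) =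
      HahnSeries.single (expo k) (if j = k then (1 : ℝ) else 0) := by
    ext m
    rw [coeff_theta, HahnSeries.coeff_single, HahnSeries.coeff_single]
    by_cases hm : m = expo k
    · subst hm
      by_cases hjk : j = k
      · simp [expo, hjk]
      · simp [expo, hjk]
    · simp [hm]
  rw [iterDeriv, Derivation.smul_apply, h, smul_eq_mul, HahnSeries.single_mul_single]
  by_cases hjk : j = k
  · simp [hjk]
  · simp [hjk]

/-- The iterated residue: the coefficient of `1 / (y_1 ⋯ y_r)`. -/
def iterRes (r : ℕ) : Iter r →ₗ[ℝ] ℝ := HahnSeries.coeff.linearMap (toLex fun _ => -1)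

theorem iterRes_apply {r : ℕ} (f : Iter r) : iterRes r f = f.coeff (toLex fun _ => -1) := rfl

/-- In a derivative with respect to y_j, a monomial with y_j-exponent -1 carries the factor -1 + 1.
-/
theorem iterRes_iterDeriv {r : ℕ} (j : Fin r) (f : Iter r) : iterRes r (iterDeriv j f) = 0 := by
  rw [iterRes_apply, coeff_iterDeriv]
  simp

/-! ### Trees directed to the last vertex -/

/-- The coordinate `x_i` as an iterated Laurent series in the edge variables
`y_j = x_j - x_{p(j)}` of the tree given by the parent function `p`. -/
def treeVar {r : ℕ} (p : Fin r → Fin (r + 1)) (hp : ∀ j, j.castSucc < p j) (i : Fin (r + 1)) :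
    Iter r :=
  if h : i = Fin.last r then 0
  else HahnSeries.single (expo (i.castPred h)) 1 + treeVar p hp (p (i.castPred h))
termination_by r - (i : ℕ)
decreasing_by
  have h1 := hp (i.castPred h)
  rw [Fin.lt_def] at h1
  have h2 := (p (i.castPred h)).is_le
  simp at h1
  omega

variable {r : ℕ} {p : Fin r → Fin (r + 1)} (hp : ∀ j, j.castSucc < p j)

theorem treeVar_last : treeVar p hp (Fin.last r) = 0 := by
  rw [treeVar]
  simp

theorem treeVar_castSucc (j : Fin r) :
    treeVar p hp j.castSucc = HahnSeries.single (expo j) 1 + treeVar p hp (p j) := by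
  rw [treeVar]
  simp [Fin.castSucc_ne_last]

/-- Induction along the branches of a tree directed to the last vertex. -/
theorem tree_induction (hp : ∀ j, j.castSucc < p j) {motive : Fin (r + 1) → Prop}
    (last : motive (Fin.last r)) (step : ∀ j : Fin r, motive (p j) → motive j.castSucc)
    (i : Fin (r + 1)) : motive i := by
  induction hn : r - (i : ℕ) using Nat.strong_induction_on generalizing i with
  | _ n ih =>
    refine Fin.lastCases (fun _ => last) (fun j hn => ?_) i hn
    refine step j (ih _ ?_ _ rfl)
    have h1 := hp j
    rw [Fin.lt_def] at h1
    have h2 := (p j).is_le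
    simp at h1 hn
    omega

/-- The series of x_i is the sum of the y_j over the edges of the path from i to the last vertex,
and the labels increase along this path. -/
theorem coeff_treeVar_ne_zero {i : Fin (r + 1)} {m : Lex (Fin r → ℤ)}
    (hm : (treeVar p hp i).coeff m ≠ 0) : ∃ j : Fin r, i ≤ j.castSucc ∧ m = expo j := by
  induction i using tree_induction hp with
  | last =>
    rw [treeVar_last] at hm
    simp at hm
  | step j ih =>
    rw [treeVar_castSucc, HahnSeries.coeff_add] at hm
    by_cases h : m = expo j
    · exact ⟨j, le_rfl, h⟩
    · rw [HahnSeries.coeff_single_of_ne h, zero_add] at hm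
      obtain ⟨k, hk, rfl⟩ := ih hm
      exact ⟨k, (hp j).le.trans hk, rfl⟩

/-- The partial derivative `∂/∂x_k` in the edge variables of a tree. -/
def treeDeriv (p : Fin r → Fin (r + 1)) (k : Fin r) : Derivation ℝ (Iter r) (Iter r) :=
  ∑ j, ((if j = k then 1 else 0) - (if p j = k.castSucc then 1 else 0) : ℝ) • iterDeriv j

theorem treeDeriv_apply (k : Fin r) (f : Iter r) : treeDeriv p k f =
    ∑ j, ((if j = k then 1 else 0) - (if p j = k.castSucc then 1 else 0) : ℝ) • iterDeriv j f :=
  derivation_sum_apply _ _ _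

theorem iterRes_treeDeriv (k : Fin r) (f : Iter r) : iterRes r (treeDeriv p k f) = 0 := by
  rw [treeDeriv_apply, map_sum]
  exact Finset.sum_eq_zero fun j _ => by rw [map_smul, iterRes_iterDeriv, smul_zero]

theorem sub_ite_smul_one_add_ite {K : Type*} [Field K] [Algebra ℝ K] (P Q : Prop) [Decidable P]
    [Decidable Q] : ((if P then 1 else 0) - (if Q then 1 else 0) : ℝ) • (1 : K) +
      (if Q then 1 else 0) = if P then 1 else 0 := by
  split_ifs <;> simp

/-- The coefficients of `treeDeriv` are ∂y_j/∂x_k for y_j = x_j - x_{p(j)}, so this is the chain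
rule. It makes the expansion of rational functions commute with ∂/∂x_k. -/
theorem treeDeriv_treeVar (k : Fin r) (i : Fin (r + 1)) :
    treeDeriv p k (treeVar p hp i) = if i = k.castSucc then 1 else 0 := by
  induction i using tree_induction hp with
  | last => simp [treeVar_last, (Fin.castSucc_ne_last k).symm]
  | step j ih =>
    rw [treeVar_castSucc, map_add, ih, treeDeriv_apply]
    simp only [iterDeriv_single, smul_ite, smul_zero, Finset.sum_ite_eq', Finset.mem_univ, if_true,
      Fin.castSucc_inj]
    exact sub_ite_smul_one_add_ite _ _

/-- Polynomials as iterated Laurent series in the edge variables of a tree. -/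
def treePoly : MvPolynomial (Fin r) ℝ →ₐ[ℝ] Iter r :=
  MvPolynomial.aeval fun i => treeVar p hp i.castSucc

theorem treePoly_pderiv (k : Fin r) (P : MvPolynomial (Fin r) ℝ) :
    treePoly hp (MvPolynomial.pderiv k P) = treeDeriv p k (treePoly hp P) := by
  induction P using MvPolynomial.induction_on with
  | C c =>
    rw [MvPolynomial.pderiv_C, map_zero, treePoly, MvPolynomial.aeval_C,
      Derivation.map_algebraMap]
  | add P Q hP hQ => simp only [map_add, hP, hQ]
  | mul_X P i hP =>
    have hX : treePoly hp (MvPolynomial.X i) = treeVar p hp i.castSucc :=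
      MvPolynomial.aeval_X _ _
    rw [MvPolynomial.pderiv_mul, MvPolynomial.pderiv_X, map_add, map_mul, map_mul, map_mul,
      Derivation.leibniz, hP, hX, treeDeriv_treeVar, smul_eq_mul, smul_eq_mul, Pi.single_apply]
    by_cases h : i = k
    · simp [h]
      ring
    · simp [h, mul_comm]

theorem eq_C_of_pderiv_eq_zero {P : MvPolynomial (Fin r) ℝ}
    (h : ∀ k, MvPolynomial.pderiv k P = 0) : ∃ c, P = MvPolynomial.C c := by
  refine ⟨MvPolynomial.constantCoeff P, ?_⟩
  apply MvPolynomial.coe_injective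
  refine MvPowerSeries.pderiv.ext (fun k => ?_) ?_
  · rw [MvPowerSeries.pderiv_coe, MvPowerSeries.pderiv_coe, h k, MvPolynomial.pderiv_C]
  · rw [← MvPowerSeries.coeff_zero_eq_constantCoeff_apply,
      ← MvPowerSeries.coeff_zero_eq_constantCoeff_apply, MvPolynomial.coeff_coe,
      MvPolynomial.coeff_coe]
    simp [MvPolynomial.constantCoeff_eq]

/-- The kernel is stable under all partial derivatives, which lower the degree. By induction on the
degree bound an element of the kernel has vanishing derivatives, so it is a constant, and nonzero
constants are not killed. -/
theorem treePoly_injective : Function.Injective (treePoly hp) := by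
  rw [injective_iff_map_eq_zero]
  suffices H : ∀ (d : ℕ) (P : MvPolynomial (Fin r) ℝ), (∀ m, P.coeff m ≠ 0 → m.degree < d) →
      treePoly hp P = 0 → P = 0 by
    intro P hP
    refine H (P.support.sup Finsupp.degree + 1) P (fun m hm => Nat.lt_succ_of_le ?_) hP
    exact Finset.le_sup (f := Finsupp.degree) (MvPolynomial.mem_support_iff.mpr hm)
  intro d
  induction d with
  | zero =>
    intro P hd _
    ext m
    by_contra hm
    exact absurd (hd m hm) (Nat.not_lt_zero _)
  | succ d ih =>
    intro P hd hP
    have hder : ∀ k, MvPolynomial.pderiv k P = 0 := by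
      intro k
      refine ih _ (fun m hm => ?_) (by rw [treePoly_pderiv, hP, map_zero])
      rw [MvPolynomial.coeff_pderiv] at hm
      have := hd _ (left_ne_zero_of_mul hm)
      rw [map_add, Finsupp.degree_single] at this
      omega
    obtain ⟨c, rfl⟩ := eq_C_of_pderiv_eq_zero hder
    rw [treePoly, MvPolynomial.aeval_C] at hP
    rw [(map_eq_zero_iff _ (algebraMap ℝ (Iter r)).injective).mp hP, map_zero]

/-- Rational functions as iterated Laurent series in the edge variables of a tree. -/
def treeRat : RatFun r →ₐ[ℝ] Iter r := IsFractionRing.liftAlgHom (treePoly_injective hp)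

theorem treeRat_toRat (P : MvPolynomial (Fin r) ℝ) : treeRat hp (toRat P) = treePoly hp P := by
  rw [treeRat, IsFractionRing.liftAlgHom_apply, toRat, IsFractionRing.lift_algebraMap]
  rfl

theorem iterRes_treeRat_of_mem_derivSpace {Δ : Set (Fin (r + 1) → ℝ)} {f : RatFun r}
    (hf : f ∈ derivSpace Δ) : iterRes r (treeRat hp f) = 0 := by
  induction hf using Submodule.span_induction with
  | zero => simp
  | add f g _ _ hf hg => rw [map_add, map_add, hf, hg, add_zero]
  | smul c f _ hf => rw [map_smul, map_smul, hf, smul_zero]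
  | mem f hf =>
    obtain ⟨k, P, l, -, rfl⟩ := hf
    rw [map_div₀, map_pow, treeRat_toRat, treeRat_toRat, map_sub, map_mul, map_mul,
      treePoly_pderiv, treePoly_pderiv]
    have h := Derivation.leibniz_div (treeDeriv p k) (treePoly hp P) (treePoly hp (formProd l))
    rw [← iterRes_treeDeriv (p := p) k (treePoly hp P / treePoly hp (formProd l)), h]
    congr 1
    simp only [smul_eq_mul]
    rw [div_eq_inv_mul, inv_pow]
    ring

/-! ### The simple fractions given by trees -/

/-- The function `∏_j 1 / (x_j - x_{q(j)})`. -/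
def treeFrac (q : Fin r → Fin (r + 1)) : RatFun r :=
  ∏ j, (toRat (linForm (root j.castSucc (q j))))⁻¹

theorem sum_root_smul {M : Type*} [AddCommGroup M] [Module ℝ M] (Y : Fin (r + 1) → M)
    (hY : Y (Fin.last r) = 0) (i j : Fin (r + 1)) :
    ∑ k : Fin r, root i j k.castSucc • Y k.castSucc = Y i - Y j := by
  have h := Fin.sum_univ_castSucc fun k => root i j k • Y k
  rw [hY, smul_zero, add_zero] at h
  rw [← h]
  simp [root, sub_smul, Finset.sum_sub_distrib, Pi.single_apply, ite_smul]

theorem treePoly_root (i j : Fin (r + 1)) :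
    treePoly hp (linForm (root i j)) = treeVar p hp i - treeVar p hp j := by
  rw [← sum_root_smul _ (treeVar_last hp), linForm, map_sum]
  refine Finset.sum_congr rfl fun k _ => ?_
  rw [← MvPolynomial.smul_eq_C_mul, map_smul, treePoly, MvPolynomial.aeval_X]

theorem linForm_root_ne_zero {i j : Fin (r + 1)} (h : i < j) : linForm (root i j) ≠ 0 :=
  linForm_ne_zero subset_rfl (Or.inl ⟨i, j, h, rfl⟩)

theorem linForm_root_swap (i j : Fin (r + 1)) : linForm (root i j) = -linForm (root j i) := by
  have h : root i j = -root j i := by simp [root]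
  rw [h, ← linFormHom_apply, map_neg, linFormHom_apply]

theorem treeVar_sub_ne_zero {i j : Fin (r + 1)} (h : i ≠ j) :
    treeVar p hp i - treeVar p hp j ≠ 0 := by
  rw [← treePoly_root, Ne, map_eq_zero_iff _ (treePoly_injective hp)]
  rcases h.lt_or_gt with h | h
  · exact linForm_root_ne_zero h
  · rw [linForm_root_swap, neg_eq_zero]
    exact linForm_root_ne_zero h

theorem order_treeVar_sub {i j : Fin (r + 1)} (h : i ≠ j) :
    ∃ k : Fin r, (i ≤ k.castSucc ∨ j ≤ k.castSucc) ∧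
      (treeVar p hp i - treeVar p hp j).order = expo k := by
  have h1 : (treeVar p hp i - treeVar p hp j).coeff (treeVar p hp i - treeVar p hp j).order ≠ 0 :=
    HahnSeries.coeff_order_eq_zero.not.mpr (treeVar_sub_ne_zero hp h)
  rw [HahnSeries.coeff_sub] at h1
  by_cases h2 : (treeVar p hp i).coeff (treeVar p hp i - treeVar p hp j).order = 0
  · rw [h2, zero_sub, neg_ne_zero] at h1
    obtain ⟨k, hk, hk'⟩ := coeff_treeVar_ne_zero hp h1
    exact ⟨k, Or.inr hk, hk'⟩
  · obtain ⟨k, hk, hk'⟩ := coeff_treeVar_ne_zero hp h2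
    exact ⟨k, Or.inl hk, hk'⟩

/-- The lexicographic order reads the first exponent first. So among linear terms in the y_j the one
of largest index is the leading one. -/
theorem expo_lt_expo {i j : Fin r} (h : i < j) : expo j < expo i := by
  refine ⟨i, fun k hk => ?_, ?_⟩
  · change (Pi.single j (1 : ℤ) : Fin r → ℤ) k = (Pi.single i (1 : ℤ) : Fin r → ℤ) k
    rw [Pi.single_eq_of_ne (hk.trans h).ne, Pi.single_eq_of_ne hk.ne]
  · change (Pi.single j (1 : ℤ) : Fin r → ℤ) i < (Pi.single i (1 : ℤ) : Fin r → ℤ) i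
    rw [Pi.single_eq_of_ne h.ne, Pi.single_eq_same]
    exact one_pos

/-- Here x_j - x_{q(j)} = y_j + (x_{p(j)} - x_{q(j)}). The second summand is nonzero and involves
only variables of index above j, so it dominates y_j. -/
theorem order_treeVar_sub_of_ne {q : Fin r → Fin (r + 1)} (hq : ∀ j, j.castSucc < q j) {j : Fin r}
    (h : p j ≠ q j) : ∃ k : Fin r, j < k ∧
      (treeVar p hp j.castSucc - treeVar p hp (q j)).order = expo k := by
  obtain ⟨k, hk, hk'⟩ := order_treeVar_sub hp h
  have hjk : j < k := by
    rw [← Fin.castSucc_lt_castSucc_iff]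
    exact hk.elim (fun h => (hp j).trans_le h) fun h => (hq j).trans_le h
  refine ⟨k, hjk, ?_⟩
  obtain ⟨k', hk1, hk2⟩ := order_treeVar_sub hp (hq j).ne
  rw [hk2]
  have h0 := treeVar_sub_ne_zero hp (hq j).ne
  have h1 : (treeVar p hp j.castSucc - treeVar p hp (q j)).coeff (expo k) ≠ 0 := by
    rw [treeVar_castSucc, add_sub_assoc, HahnSeries.coeff_add, HahnSeries.coeff_single_of_ne
      (expo_lt_expo hjk).ne, zero_add, ← hk']
    exact HahnSeries.coeff_order_eq_zero.not.mpr (treeVar_sub_ne_zero hp h)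
  have h2 := HahnSeries.order_le_of_coeff_ne_zero h1
  rw [hk2] at h2
  have h3 : (treeVar p hp j.castSucc - treeVar p hp (q j)).coeff (expo k') ≠ 0 := by
    rw [← hk2]
    exact HahnSeries.coeff_order_eq_zero.not.mpr h0
  rw [treeVar_castSucc, add_sub_assoc, HahnSeries.coeff_add, HahnSeries.coeff_single_of_ne
    (h2.trans_lt (expo_lt_expo hjk)).ne, zero_add] at h3
  have h4 := HahnSeries.order_le_of_coeff_ne_zero h3
  rw [hk'] at h4
  exact le_antisymm h2 h4

theorem order_prod_inv {ι : Type*} (s : Finset ι) (F : ι → Iter r) (hF : ∀ i ∈ s, F i ≠ 0) :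
    (∏ i ∈ s, (F i)⁻¹).order = -∑ i ∈ s, (F i).order := by
  classical
  induction s using Finset.induction_on with
  | empty => simp
  | insert i s hi ih =>
    have h1 := hF i (Finset.mem_insert_self i s)
    have h2 : ∀ j ∈ s, F j ≠ 0 := fun j hj => hF j (Finset.mem_insert_of_mem hj)
    have h3 := HahnSeries.order_mul h1 (inv_ne_zero h1)
    rw [mul_inv_cancel₀ h1, HahnSeries.order_one] at h3
    rw [Finset.prod_insert hi, Finset.sum_insert hi, HahnSeries.order_mul (inv_ne_zero h1)
      (Finset.prod_ne_zero_iff.mpr fun j hj => inv_ne_zero (h2 j hj)), ih h2, neg_add,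
      eq_neg_of_add_eq_zero_right h3.symm]

theorem treeRat_treeFrac (q : Fin r → Fin (r + 1)) : treeRat hp (treeFrac q) =
    ∏ j, (treeVar p hp j.castSucc - treeVar p hp (q j))⁻¹ := by
  rw [treeFrac, map_prod]
  refine Finset.prod_congr rfl fun j _ => ?_
  rw [map_inv₀, treeRat_toRat, treePoly_root]

theorem prod_single {ι : Type*} (s : Finset ι) (m : ι → Lex (Fin r → ℤ)) :
    ∏ i ∈ s, HahnSeries.single (m i) (1 : ℝ) = HahnSeries.single (∑ i ∈ s, m i) 1 := by
  classical
  induction s using Finset.induction_on with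
  | empty => simp
  | insert i s hi ih =>
    rw [Finset.prod_insert hi, ih, HahnSeries.single_mul_single, Finset.sum_insert hi, mul_one]

theorem iterRes_treeFrac_self : iterRes r (treeRat hp (treeFrac p)) = 1 := by
  have h1 : ∀ j, treeVar p hp j.castSucc - treeVar p hp (p j) = HahnSeries.single (expo j) 1 := by
    intro j
    rw [treeVar_castSucc, add_sub_cancel_right]
  have h2 : ∑ j : Fin r, expo j = toLex fun _ => 1 := by
    apply ofLex.injective
    funext i
    have : ofLex (∑ j : Fin r, expo j) = ∑ j : Fin r, Pi.single j (1 : ℤ) := rfl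
    rw [this, Finset.sum_apply]
    simp [Pi.single_apply]
  have h3 : treeRat hp (treeFrac p) = HahnSeries.single (toLex fun _ => -1) 1 := by
    rw [treeRat_treeFrac, Finset.prod_congr rfl fun j _ => by rw [h1 j],
      Finset.prod_inv_distrib, prod_single, h2]
    refine inv_eq_of_mul_eq_one_right ?_
    rw [HahnSeries.single_mul_single, mul_one]
    have : (toLex fun _ => 1 : Lex (Fin r → ℤ)) + toLex (fun _ => -1) = 0 := by
      apply ofLex.injective
      funext i
      exact add_neg_cancel (1 : ℤ)
    rw [this]
    rfl
  rw [h3, iterRes_apply, HahnSeries.coeff_single_same]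

/-- Let j be the first index with p(j) ≠ q(j). Factors of index below j are exactly 1/y_i, while all
others have leading variable of index above j. The leading exponent of the product thus agrees with
(-1,…,-1) before j and is 0 at j, so it exceeds (-1,…,-1), whose coefficient must vanish. -/
theorem iterRes_treeFrac_of_ne {q : Fin r → Fin (r + 1)} (hq : ∀ j, j.castSucc < q j)
    (hpq : p ≠ q) : iterRes r (treeRat hp (treeFrac q)) = 0 := by
  obtain ⟨j, hj, hmin⟩ : ∃ j, p j ≠ q j ∧ ∀ i < j, p i = q i := by
    obtain ⟨j, hj⟩ := Function.ne_iff.mp hpq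
    obtain ⟨j, hj, hmin⟩ := WellFounded.has_min (wellFounded_lt (α := Fin r)) {j | p j ≠ q j}
      ⟨j, hj⟩
    exact ⟨j, hj, fun i hi => by_contra fun h => hmin i h hi⟩
  rw [iterRes_apply, treeRat_treeFrac]
  refine HahnSeries.coeff_eq_zero_of_lt_order ?_
  rw [order_prod_inv _ _ fun i _ => treeVar_sub_ne_zero hp (hq i).ne]
  have hord : ∀ i : Fin r, ∃ k, (treeVar p hp i.castSucc - treeVar p hp (q i)).order = expo k ∧
      (i < j → k = i) ∧ (j ≤ i → j < k) := by
    intro i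
    rcases lt_trichotomy i j with h | h | h
    · refine ⟨i, ?_, fun _ => rfl, fun h' => absurd h' h.not_ge⟩
      rw [treeVar_castSucc, hmin i h, add_sub_cancel_right, HahnSeries.order_single one_ne_zero]
    · subst h
      obtain ⟨k, hk, hk'⟩ := order_treeVar_sub_of_ne hp hq hj
      exact ⟨k, hk', fun h => absurd h (lt_irrefl _), fun _ => hk⟩
    · obtain ⟨k, hk, hk'⟩ := order_treeVar_sub hp (hq i).ne
      have hik : i ≤ k := by
        rw [← Fin.castSucc_le_castSucc_iff]
        exact hk.elim id (hq i).le.trans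
      exact ⟨k, hk', fun h' => absurd h' h.le.not_gt, fun _ => h.trans_le hik⟩
  choose k hk1 hk2 hk3 using hord
  rw [Finset.sum_congr rfl fun i _ => hk1 i]
  have hcoord : ∀ i, ofLex (-∑ i, expo (k i)) i = -∑ l, if k l = i then (1 : ℤ) else 0 := by
    intro i
    have : ofLex (-∑ i, expo (k i)) = -∑ l, Pi.single (k l) (1 : ℤ) := rfl
    rw [this, Pi.neg_apply, Finset.sum_apply]
    simp [Pi.single_apply, eq_comm]
  refine ⟨j, fun i hi => ?_, ?_⟩
  · change (-1 : ℤ) = ofLex (-∑ i, expo (k i)) i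
    rw [hcoord, Finset.sum_eq_single i]
    · rw [if_pos (hk2 i hi)]
    · intro l _ hl
      refine if_neg fun h => ?_
      rcases lt_or_ge l j with hlj | hlj
      · exact hl ((hk2 l hlj).symm.trans h)
      · exact absurd (hi.trans (hk3 l hlj)) (h ▸ lt_irrefl _)
    · simp
  · change (-1 : ℤ) < ofLex (-∑ i, expo (k i)) j
    rw [hcoord, Finset.sum_eq_zero]
    · simp
    · intro l _
      refine if_neg fun h => ?_
      rcases lt_or_ge l j with hlj | hlj
      · exact hlj.ne ((hk2 l hlj).symm.trans h)
      · exact (hk3 l hlj).ne h.symm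

/-- The span of the simple fractions given by trees meets `∂(V) R_Δ` in `0`. -/
theorem disjoint_span_treeFrac_derivSpace (Δ : Set (Fin (r + 1) → ℝ)) :
    Disjoint (Submodule.span ℝ {f | ∃ q : Fin r → Fin (r + 1), (∀ j, j.castSucc < q j) ∧
      f = treeFrac q}) (derivSpace Δ) := by
  classical
  have hset : {f | ∃ q : Fin r → Fin (r + 1), (∀ j, j.castSucc < q j) ∧ f = treeFrac q} =
      Set.range fun q : {q : Fin r → Fin (r + 1) // ∀ j, j.castSucc < q j} => treeFrac q.1 := by
    ext f
    constructor
    · rintro ⟨q, hq, rfl⟩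
      exact ⟨⟨q, hq⟩, rfl⟩
    · rintro ⟨q, rfl⟩
      exact ⟨q.1, q.2, rfl⟩
  rw [Submodule.disjoint_def, hset]
  intro f hf hfD
  obtain ⟨c, rfl⟩ := (Submodule.mem_span_range_iff_exists_fun ℝ).mp hf
  refine Finset.sum_eq_zero fun p _ => ?_
  -- The residue along the tree p isolates the coefficient of its own fraction.
  have h := iterRes_treeRat_of_mem_derivSpace p.2 hfD
  rw [map_sum, map_sum, Finset.sum_eq_single p] at h
  · rw [map_smul, map_smul, iterRes_treeFrac_self, smul_eq_mul, mul_one] at h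
    rw [h, zero_smul]
  · intro q _ hq
    rw [map_smul, map_smul, iterRes_treeFrac_of_ne p.2 q.2 fun h => hq (Subtype.ext h.symm),
      smul_zero]
  · simp

end

noncomputable section

/-! ### Simple fractions are combinations of those given by trees -/

theorem linearIndepOn_update {ι E : Type*} [DecidableEq ι] [AddCommGroup E] [Module ℝ E]
    {v : ι → E} {s : Set ι} (hv : LinearIndepOn ℝ v s) {i : ι} (hi : i ∈ s) {w : E}
    (hw : w ∉ Submodule.span ℝ (v '' (s \ {i}))) :
    LinearIndepOn ℝ (Function.update v i w) s := by
  have hs : s = insert i (s \ {i}) := by simp [Set.insert_eq_of_mem hi]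
  have heq : Set.EqOn v (Function.update v i w) (s \ {i}) := fun j hj =>
    (Function.update_of_ne hj.2 _ _).symm
  rw [hs, linearIndepOn_insert (by simp), Function.update_self, ← heq.image_eq]
  exact ⟨(hv.mono Set.sdiff_subset).congr heq, hw⟩

theorem root_self_sub {r : ℕ} (k a b : Fin (r + 1)) : root k b - root k a = root a b := by
  simp only [root]
  abel

theorem root_apply_eq_zero {r : ℕ} {k a b : Fin (r + 1)} (ha : k ≠ a) (hb : k ≠ b) :
    root a b k = 0 := by
  simp [root, ha, hb]

theorem root_apply_self {r : ℕ} {k a : Fin (r + 1)} (ha : k ≠ a) : root k a k = 1 := by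
  simp [root, ha]

/-- The span of the functions `∏_{j ∈ J} 1 / (x_j - x_{q(j)})` for sets `J` of `n` indices `≥ k`. -/
def forestSpan (r k n : ℕ) : Submodule ℝ (RatFun r) :=
  Submodule.span ℝ {f | ∃ (J : Finset (Fin r)) (q : Fin r → Fin (r + 1)),
    (∀ j ∈ J, k ≤ j) ∧ J.card = n ∧ (∀ j, j.castSucc < q j) ∧
    f = ∏ j ∈ J, (toRat (linForm (root j.castSucc (q j))))⁻¹}

theorem forestSpan_mono {r k k' n : ℕ} (h : k ≤ k') : forestSpan r k' n ≤ forestSpan r k n := by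
  refine Submodule.span_mono ?_
  rintro _ ⟨J, q, hJ, hn, hq, rfl⟩
  exact ⟨J, q, fun j hj => h.trans (hJ j hj), hn, hq, rfl⟩

theorem inv_root_mul_mem_forestSpan {r n : ℕ} {k : Fin r} {a : Fin (r + 1)} (ha : k.castSucc < a)
    {f : RatFun r} (hf : f ∈ forestSpan r (k + 1) n) :
    (ratForm r (root k.castSucc a))⁻¹ * f ∈ forestSpan r k (n + 1) := by
  classical
  induction hf using Submodule.span_induction with
  | zero => simp
  | add f g _ _ hf hg =>
    rw [mul_add]
    exact Submodule.add_mem _ hf hg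
  | smul c f _ hf =>
    rw [mul_smul_comm]
    exact Submodule.smul_mem _ _ hf
  | mem f hf =>
    obtain ⟨J, q, hJ, hn, hq, rfl⟩ := hf
    have hk : k ∉ J := fun h => by simpa using hJ k h
    refine Submodule.subset_span ⟨insert k J, Function.update q k a, ?_, ?_, ?_, ?_⟩
    · intro j hj
      rcases Finset.mem_insert.mp hj with rfl | hj
      · exact le_rfl
      · exact (Nat.le_succ _).trans (hJ j hj)
    · rw [Finset.card_insert_of_notMem hk, hn]
    · intro j
      by_cases h : j = k
      · subst h
        rwa [Function.update_self]
      · rw [Function.update_of_ne h]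
        exact hq j
    · rw [Finset.prod_insert hk, Function.update_self, ratForm_apply]
      congr 1
      refine Finset.prod_congr rfl fun j hj => ?_
      rw [Function.update_of_ne (ne_of_mem_of_not_mem hj hk)]

/-- For A = x_k - x_a and B = x_k - x_b the difference B - A is x_a - x_b, so in each term on the
right one of the two factors involving x_k is replaced by one free of it. -/
theorem inv_mul_inv_eq_sub {K : Type*} [Field K] {A B : K} (hA : A ≠ 0) (hB : B ≠ 0)
    (h : B - A ≠ 0) : A⁻¹ * B⁻¹ = A⁻¹ * (B - A)⁻¹ - (B - A)⁻¹ * B⁻¹ := by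
  field_simp

theorem ratForm_root_ne_zero {r : ℕ} {i j : Fin (r + 1)} (h : i < j) : ratForm r (root i j) ≠ 0 :=
  toRat_eq_zero.not.mpr (linForm_root_ne_zero h)

/-- Indices are eliminated in increasing order. As long as two roots e^k - e^a and e^k - e^b occur,
the three-term identity replaces one of them by e^a - e^b. Once at most one root starts at k it
serves as the edge leaving k, and the remaining roots only involve indices above k. -/
theorem prod_inv_mem_forestSpan {ι : Type*} [DecidableEq ι] {r : ℕ} (d k : ℕ) (hk : k + d = r)
    (s : Finset ι) (v : ι → Fin (r + 1) → ℝ) (hv : LinearIndepOn ℝ v (s : Set ι))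
    (hroot : ∀ i ∈ s, ∃ a b : Fin (r + 1), k ≤ a ∧ a < b ∧ v i = root a b) :
    ∏ i ∈ s, (ratForm r (v i))⁻¹ ∈ forestSpan r k s.card := by
  induction d generalizing k s v with
  | zero =>
    have hs : s = ∅ := by
      refine Finset.eq_empty_of_forall_notMem fun i hi => ?_
      obtain ⟨a, b, hka, hab, -⟩ := hroot i hi
      have := b.is_le
      rw [Fin.lt_def] at hab
      omega
    subst hs
    exact Submodule.subset_span ⟨∅, fun _ => Fin.last r, by simp, by simp, Fin.castSucc_lt_last,
      by simp⟩
  | succ d ih =>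
    let κ : Fin r := ⟨k, by omega⟩
    have hκ : ∀ a : Fin (r + 1), k ≤ a → a ≠ κ.castSucc → k + 1 ≤ a := by
      intro a h1 h2
      have h3 : (a : ℕ) ≠ k := fun h => h2 (Fin.ext h)
      omega
    -- The inner induction is on the number of roots that start at k.
    induction hc : (s.filter fun i => v i κ.castSucc ≠ 0).card using Nat.strong_induction_on
      generalizing v with
    | _ c ihc =>
    have hmem : ∀ i ∈ s, v i κ.castSucc ≠ 0 → ∃ a, κ.castSucc < a ∧ v i = root κ.castSucc a := by
      intro i hi h
      obtain ⟨a, b, hka, hab, hvi⟩ := hroot i hi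
      by_cases ha : a = κ.castSucc
      · subst ha
        exact ⟨b, hab, hvi⟩
      · refine absurd ?_ h
        have h1 := hκ a hka ha
        rw [hvi, root_apply_eq_zero (Ne.symm ha)]
        intro hb
        rw [Fin.lt_def, ← hb] at hab
        simp [κ] at hab
        omega
    have hnot : ∀ i ∈ s, v i κ.castSucc = 0 →
        ∃ a b : Fin (r + 1), k + 1 ≤ a ∧ a < b ∧ v i = root a b := by
      intro i hi h
      obtain ⟨a, b, hka, hab, hvi⟩ := hroot i hi
      refine ⟨a, b, hκ a hka fun ha => ?_, hab, hvi⟩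
      subst ha
      rw [hvi, root_apply_self hab.ne] at h
      exact one_ne_zero h
    rcases (s.filter fun i => v i κ.castSucc ≠ 0).eq_empty_or_nonempty with he | ⟨i₁, hi₁⟩
    · refine forestSpan_mono (Nat.le_succ k) (ih (k + 1) (by omega) s v hv fun i hi => ?_)
      refine hnot i hi (by_contra fun h => ?_)
      have : i ∈ s.filter fun i => v i κ.castSucc ≠ 0 := Finset.mem_filter.mpr ⟨hi, h⟩
      rw [he] at this
      exact Finset.notMem_empty _ this
    obtain ⟨hi₁s, hi₁k⟩ := Finset.mem_filter.mp hi₁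
    by_cases hall : ∀ i ∈ s, v i κ.castSucc ≠ 0 → i = i₁
    · obtain ⟨a, ha, hva⟩ := hmem i₁ hi₁s hi₁k
      have h1 := ih (k + 1) (by omega) (s.erase i₁) v
        (hv.mono fun i hi => Finset.mem_of_mem_erase hi) fun i hi =>
          hnot i (Finset.mem_of_mem_erase hi)
            (by_contra fun h => Finset.ne_of_mem_erase hi
              (hall i (Finset.mem_of_mem_erase hi) h))
      have h2 := inv_root_mul_mem_forestSpan (k := κ) ha h1
      rw [← Finset.mul_prod_erase s _ hi₁s, hva]
      rwa [Finset.card_erase_add_one hi₁s] at h2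
    push Not at hall
    obtain ⟨i₂, hi₂s, hi₂k, hne⟩ := hall
    have key : ∀ i₁ ∈ s, ∀ i₂ ∈ s, i₁ ≠ i₂ → ∀ a b, κ.castSucc < a → a < b →
        v i₁ = root κ.castSucc a → v i₂ = root κ.castSucc b →
        ∏ i ∈ s, (ratForm r (v i))⁻¹ ∈ forestSpan r k s.card := by
      intro i₁ hi₁ i₂ hi₂ hne a b ha hab hv₁ hv₂
      have hsub : v i₂ - v i₁ = root a b := by rw [hv₁, hv₂, root_self_sub]
      have hab0 : root a b κ.castSucc = 0 := root_apply_eq_zero ha.ne (ha.trans hab).ne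
      have hstep : ∀ i ∈ s, v i κ.castSucc ≠ 0 →
          root a b ∉ Submodule.span ℝ (v '' ((s : Set ι) \ {i})) →
          ∏ j ∈ s, (ratForm r (Function.update v i (root a b) j))⁻¹ ∈ forestSpan r k s.card := by
        intro i hi hik hspan
        refine ihc _ ?_ (Function.update v i (root a b))
          (linearIndepOn_update hv (Finset.mem_coe.mpr hi) hspan) (fun j hj => ?_) rfl
        · rw [← hc]
          refine Finset.card_lt_card (Finset.ssubset_iff_subset_ne.mpr ⟨fun j hj => ?_, fun h => ?_⟩)
          · obtain ⟨hjs, hj⟩ := Finset.mem_filter.mp hj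
            by_cases hji : j = i
            · subst hji
              rw [Function.update_self] at hj
              exact absurd hab0 hj
            · rw [Function.update_of_ne hji] at hj
              exact Finset.mem_filter.mpr ⟨hjs, hj⟩
          · have h1 : i ∈ s.filter fun i => v i κ.castSucc ≠ 0 := Finset.mem_filter.mpr ⟨hi, hik⟩
            rw [← h] at h1
            have h2 := (Finset.mem_filter.mp h1).2
            rw [Function.update_self] at h2
            exact h2 hab0
        · by_cases hji : j = i
          · subst hji
            refine ⟨a, b, ?_, hab, Function.update_self ..⟩
            rw [Fin.lt_def] at ha
            exact ha.le
          · rw [Function.update_of_ne hji]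
            exact hroot j hj
      have hk₁ : v i₁ κ.castSucc ≠ 0 := by
        rw [hv₁, root_apply_self ha.ne]
        exact one_ne_zero
      have hk₂ : v i₂ κ.castSucc ≠ 0 := by
        rw [hv₂, root_apply_self (ha.trans hab).ne]
        exact one_ne_zero
      -- The new root is v i₂ - v i₁. If it lay in the span of the vectors other than v i₂, adding v
      -- i₁ would put v i₂ there as well, against independence. The exchange at i₁ is symmetric.
      have hs₂ := hstep i₂ hi₂ hk₂ fun h => by
        refine hv.notMem_span (Finset.mem_coe.mpr hi₂) ?_
        have h1 : v i₁ ∈ Submodule.span ℝ (v '' ((s : Set ι) \ {i₂})) :=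
          Submodule.subset_span ⟨i₁, ⟨hi₁, hne⟩, rfl⟩
        have h2 := Submodule.add_mem _ h h1
        rwa [← hsub, sub_add_cancel] at h2
      have hs₁ := hstep i₁ hi₁ hk₁ fun h => by
        refine hv.notMem_span (Finset.mem_coe.mpr hi₁) ?_
        have h1 : v i₂ ∈ Submodule.span ℝ (v '' ((s : Set ι) \ {i₁})) :=
          Submodule.subset_span ⟨i₂, ⟨hi₂, hne.symm⟩, rfl⟩
        have h2 := Submodule.sub_mem _ h1 h
        rwa [← hsub, sub_sub_cancel] at h2
      have hi₂' : i₂ ∈ s.erase i₁ := Finset.mem_erase.mpr ⟨hne.symm, hi₂⟩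
      have hsplit : ∀ w : ι → Fin (r + 1) → ℝ, ∏ j ∈ s, (ratForm r (w j))⁻¹ =
          (ratForm r (w i₁))⁻¹ * ((ratForm r (w i₂))⁻¹ *
            ∏ j ∈ (s.erase i₁).erase i₂, (ratForm r (w j))⁻¹) := fun w => by
        rw [Finset.mul_prod_erase _ (fun j => (ratForm r (w j))⁻¹) hi₂',
          Finset.mul_prod_erase _ (fun j => (ratForm r (w j))⁻¹) hi₁]
      have hrest : ∀ i, i = i₁ ∨ i = i₂ → ∏ j ∈ (s.erase i₁).erase i₂,
          (ratForm r (Function.update v i (root a b) j))⁻¹ =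
          ∏ j ∈ (s.erase i₁).erase i₂, (ratForm r (v j))⁻¹ := by
        intro i hi
        refine Finset.prod_congr rfl fun j hj => ?_
        rw [Function.update_of_ne]
        rcases hi with rfl | rfl
        · exact Finset.ne_of_mem_erase (Finset.mem_of_mem_erase hj)
        · exact Finset.ne_of_mem_erase hj
      have hfrac := inv_mul_inv_eq_sub (hv₁ ▸ ratForm_root_ne_zero ha : ratForm r (v i₁) ≠ 0)
        (hv₂ ▸ ratForm_root_ne_zero (ha.trans hab) : ratForm r (v i₂) ≠ 0)
        (by rw [← map_sub, hsub]; exact ratForm_root_ne_zero hab)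
      rw [← map_sub, hsub] at hfrac
      have hfinal : ∏ i ∈ s, (ratForm r (v i))⁻¹ =
          ∏ j ∈ s, (ratForm r (Function.update v i₂ (root a b) j))⁻¹ -
          ∏ j ∈ s, (ratForm r (Function.update v i₁ (root a b) j))⁻¹ := by
        rw [hsplit, hsplit (Function.update v i₂ _), hsplit (Function.update v i₁ _),
          hrest i₁ (Or.inl rfl), hrest i₂ (Or.inr rfl), Function.update_self, Function.update_self,
          Function.update_of_ne hne, Function.update_of_ne hne.symm, ← mul_assoc, hfrac]
        ring
      rw [hfinal]
      exact Submodule.sub_mem _ hs₂ hs₁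
    obtain ⟨a, ha, hva⟩ := hmem i₁ hi₁s hi₁k
    obtain ⟨b, hb, hvb⟩ := hmem i₂ hi₂s hi₂k
    rcases lt_trichotomy a b with h | h | h
    · exact key i₁ hi₁s i₂ hi₂s hne.symm a b ha h hva hvb
    · subst h
      exact absurd (hv.injOn hi₂s hi₁s (hvb.trans hva.symm)) hne
    · exact key i₂ hi₂s i₁ hi₁s hne b a hb h hvb hva

theorem finrank_rootSpace (r : ℕ) : Module.finrank ℝ (rootSpace r) = r := by
  have hind : LinearIndependent ℝ fun k : Fin r => root k.castSucc (Fin.last r) := by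
    rw [Fintype.linearIndependent_iff]
    intro g hg i
    have h := congrFun hg i.castSucc
    simpa [root, Pi.single_apply, Fin.castSucc_ne_last, Fin.castSucc_inj] using h
  have hspan : Submodule.span ℝ (Set.range fun k : Fin r => root k.castSucc (Fin.last r)) =
      rootSpace r := by
    refine le_antisymm (Submodule.span_le.mpr ?_) fun β hβ => ?_
    · rintro _ ⟨k, rfl⟩
      exact root_mem_rootSpace _ _
    · rw [eq_sum_root_last hβ]
      exact Submodule.sum_mem _ fun k _ => Submodule.smul_mem _ _ (Submodule.subset_span ⟨k, rfl⟩)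
  rw [← hspan, finrank_span_eq_card hind, Fintype.card_fin]

theorem IsBasisOf.card_eq {r : ℕ} {Δ : Set (Fin (r + 1) → ℝ)} {σ : Finset (Fin (r + 1) → ℝ)}
    (hσ : IsBasisOf Δ σ) : σ.card = r := by
  rw [← finrank_span_finset_eq_card hσ.2.1, hσ.2.2, finrank_rootSpace]

/-- Changing signs makes all roots of a basis positive, at the cost of a scalar and without losing
independence. A basis has r elements, so the set of starting vertices produced by the elimination is
everything and the forest is a tree. -/
theorem simpleSpace_le_span_treeFrac {r : ℕ} {D : Set (Fin (r + 1) → ℝ)} (hD : D ⊆ posRoots r) :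
    simpleSpace (symm D) ≤ Submodule.span ℝ {f | ∃ q : Fin r → Fin (r + 1),
      (∀ j, j.castSucc < q j) ∧ f = treeFrac q} := by
  classical
  refine Submodule.span_le.mpr ?_
  rintro _ ⟨σ, hσ, rfl⟩
  let u : (Fin (r + 1) → ℝ) → ℝˣ := fun β => if β ∈ posRoots r then 1 else -1
  have hu : ∀ β ∈ σ, u β • β ∈ posRoots r := by
    intro β hβ
    by_cases h : β ∈ posRoots r
    · simp [u, h]
    · have h1 : -β ∈ posRoots r := (hσ.1 hβ).elim (fun h' => absurd (hD h') h) fun h' => hD h'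
      simpa [u, h, Units.smul_def] using h1
  have hind : LinearIndepOn ℝ (fun β => u β • β) (σ : Set (Fin (r + 1) → ℝ)) :=
    LinearIndependent.units_smul hσ.2.1 fun β => u β
  have h1 := prod_inv_mem_forestSpan r 0 (by simp) σ _ hind fun β hβ => by
    obtain ⟨a, b, hab, h⟩ := hu β hβ
    exact ⟨a, b, Nat.zero_le _, hab, h⟩
  have h2 : forestSpan r 0 σ.card ≤ Submodule.span ℝ {f | ∃ q : Fin r → Fin (r + 1),
      (∀ j, j.castSucc < q j) ∧ f = treeFrac q} := by
    refine Submodule.span_mono ?_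
    rintro _ ⟨J, q, -, hJ, hq, rfl⟩
    refine ⟨q, hq, ?_⟩
    rw [hσ.card_eq] at hJ
    rw [Finset.eq_univ_of_card J (by rw [hJ, Fintype.card_fin]), treeFrac]
  have h3 : ∀ β, (toRat (linForm β))⁻¹ = (u β : ℝ) • (ratForm r (u β • β))⁻¹ := by
    intro β
    have h4 : ratForm r (u β • β) = (u β : ℝ) • ratForm r β := by
      rw [Units.smul_def, map_smul]
    rw [h4, ← ratForm_apply]
    by_cases h : β ∈ posRoots r
    · simp [u, h]
    · simp [u, h, inv_neg]
  rw [SetLike.mem_coe, ← Finset.prod_inv_distrib, Finset.prod_congr rfl fun β _ => h3 β,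
    Finset.prod_smul]
  exact Submodule.smul_mem _ _ (h2 h1)

theorem disjoint_simpleSpace_derivSpace {r : ℕ} {D : Set (Fin (r + 1) → ℝ)}
    (hD : D ⊆ posRoots r) (Δ : Set (Fin (r + 1) → ℝ)) :
    Disjoint (simpleSpace (symm D)) (derivSpace Δ) :=
  (disjoint_span_treeFrac_derivSpace Δ).mono_left (simpleSpace_le_span_treeFrac hD)

end

noncomputable section

/-! ### The total residue as a linear map -/

section TotalResidue

variable {r : ℕ} {D : Set (Fin (r + 1) → ℝ)}

/-- By directness the element picked by choice in `tresRat` is the only one possible, so any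
exhibited simple element computes the total residue. -/
theorem tresRat_eq (hD : D ⊆ posRoots r) {f : RatFun r} {g : simpleSpace (symm D)}
    (h : f - (g : RatFun r) ∈ derivSpace (symm D)) : tresRat (symm D) f = g := by
  have hex : ∃ g : simpleSpace (symm D), f - (g : RatFun r) ∈ derivSpace (symm D) := ⟨g, h⟩
  have h1 := hex.choose_spec
  rw [tresRat, dif_pos hex]
  have h2 := Submodule.sub_mem _ h h1
  rw [sub_sub_sub_cancel_left] at h2
  refine Subtype.ext (sub_eq_zero.mp ?_)
  exact Submodule.disjoint_def.mp (disjoint_simpleSpace_derivSpace hD (symm D)) _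
    (Submodule.sub_mem _ hex.choose.2 g.2) h2

theorem tresRat_of_mem_derivSpace (hD : D ⊆ posRoots r) {f : RatFun r}
    (h : f ∈ derivSpace (symm D)) : tresRat (symm D) f = 0 :=
  tresRat_eq hD (by simpa using h)

theorem sub_tresRat_mem (hD : D ⊆ posRoots r) (hspan : Submodule.span ℝ (symm D) = rootSpace r)
    {f : RatFun r} (hf : f ∈ ratRing (symm D)) :
    f - (tresRat (symm D) f : RatFun r) ∈ derivSpace (symm D) := by
  have h1 : f ∈ simpleSpace (symm D) ⊔ derivSpace (symm D) := by
    rw [simpleSpace_sup_derivSpace (fun α hα => linForm_ne_zero hD hα) hspan]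
    exact hf
  obtain ⟨g, hg, h, hh, rfl⟩ := Submodule.mem_sup.mp h1
  have h2 : g + h - ((⟨g, hg⟩ : simpleSpace (symm D)) : RatFun r) ∈ derivSpace (symm D) := by
    simpa using hh
  rw [tresRat_eq hD h2]
  exact h2

/-- The functional `P ↦ Tres (P_d / Q)`, where `P_d` is the homogeneous component of degree `d` of
the power series `P` and `Q` is a product of elements of `Δ`. -/
def fracRes (hD : D ⊆ posRoots r) (hspan : Submodule.span ℝ (symm D) = rootSpace r) (d : ℕ)
    (l : Multiset (Fin (r + 1) → ℝ)) (hl : ∀ α ∈ l, α ∈ symm D) :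
    MvPowerSeries (Fin r) ℝ →ₗ[ℝ] simpleSpace (symm D) where
  toFun P := tresRat (symm D) (toRat (homPoly d P) / toRat (formProd l))
  map_add' P P' := by
    have h : homPoly d (P + P') = homPoly d P + homPoly d P' := by
      ext m
      simp only [coeff_homPoly, MvPolynomial.coeff_add, map_add]
      split_ifs <;> simp
    refine tresRat_eq hD ?_
    have h1 := Submodule.add_mem _
      (sub_tresRat_mem hD hspan (div_formProd_mem_ratRing hl (homPoly d P)))
      (sub_tresRat_mem hD hspan (div_formProd_mem_ratRing hl (homPoly d P')))
    rw [h, toRat_add, add_div, Submodule.coe_add]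
    convert h1 using 1
    abel
  map_smul' c P := by
    have h : homPoly d (c • P) = c • homPoly d P := by
      ext m
      simp only [coeff_homPoly, MvPolynomial.coeff_smul, MvPowerSeries.coeff_smul]
      split_ifs <;> simp
    refine tresRat_eq hD ?_
    have h1 := Submodule.smul_mem _ c
      (sub_tresRat_mem hD hspan (div_formProd_mem_ratRing hl (homPoly d P)))
    rw [smul_sub] at h1
    rw [h, toRat_smul, smul_div_assoc]
    exact h1

theorem fracRes_apply (hD : D ⊆ posRoots r) (hspan : Submodule.span ℝ (symm D) = rootSpace r)
    (d : ℕ) (l : Multiset (Fin (r + 1) → ℝ)) (hl : ∀ α ∈ l, α ∈ symm D)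
    (P : MvPowerSeries (Fin r) ℝ) : fracRes hD hspan d l hl P =
      tresRat (symm D) (toRat (homPoly d P) / toRat (formProd l)) := rfl

/-- The homogeneous part is independent of the fraction representing it, so it may be read off with
the given denominator. The bound r ≤ card l selects the case in which this part has a numerator of
degree card l - r. -/
theorem tres_div_formProd (hD : D ⊆ posRoots r)
    (hspan : Submodule.span ℝ (symm D) = rootSpace r) {l : Multiset (Fin (r + 1) → ℝ)}
    (hl : ∀ α ∈ l, α ∈ symm D) (hcard : r ≤ Multiset.card l) (P : MvPowerSeries (Fin r) ℝ) :
    tres (symm D) (toHat P / toHat (formProd l : MvPowerSeries (Fin r) ℝ)) =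
      fracRes hD hspan (Multiset.card l - r) l hl P := by
  have h1 : IsHomPart (symm D) (toHat P / toHat (formProd l : MvPowerSeries (Fin r) ℝ))
      (toRat (homPoly (Multiset.card l - r) P) / toRat (formProd l)) :=
    ⟨P, l, hl, rfl, (if_pos hcard).symm⟩
  have hex : ∃ g, IsHomPart (symm D) (toHat P / toHat (formProd l : MvPowerSeries (Fin r) ℝ)) g :=
    ⟨_, h1⟩
  rw [tres, homPart, dif_pos hex, isHomPart_unique hD hex.choose_spec h1, fracRes_apply]

end TotalResidue

/-! ### Orders of power series -/

/-- The ideal of power series of order at least `d`. -/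
def orderIdeal (r d : ℕ) : Ideal (MvPowerSeries (Fin r) ℝ) where
  carrier := {f | ∀ m : Fin r →₀ ℕ, m.degree < d → MvPowerSeries.coeff m f = 0}
  zero_mem' := fun m _ => by simp
  add_mem' := fun {f g} hf hg m hm => by rw [map_add, hf m hm, hg m hm, add_zero]
  smul_mem' := fun c f hf m hm => by
    classical
    rw [smul_eq_mul, MvPowerSeries.coeff_mul]
    refine Finset.sum_eq_zero fun x hx => ?_
    have h : x.1.degree + x.2.degree = m.degree := by
      rw [← Finset.HasAntidiagonal.mem_antidiagonal.mp hx, map_add]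
    rw [hf x.2 (by omega), mul_zero]

variable {r : ℕ}

theorem orderIdeal_anti {d e : ℕ} (h : d ≤ e) : orderIdeal r e ≤ orderIdeal r d :=
  fun _ hf m hm => hf m (hm.trans_le h)

theorem mul_mem_orderIdeal {d e : ℕ} {f g : MvPowerSeries (Fin r) ℝ} (hf : f ∈ orderIdeal r d)
    (hg : g ∈ orderIdeal r e) : f * g ∈ orderIdeal r (d + e) := by
  classical
  intro m hm
  rw [MvPowerSeries.coeff_mul]
  refine Finset.sum_eq_zero fun x hx => ?_
  have h : x.1.degree + x.2.degree = m.degree := by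
    rw [← Finset.HasAntidiagonal.mem_antidiagonal.mp hx, map_add]
  by_cases h1 : x.1.degree < d
  · rw [hf x.1 h1, zero_mul]
  · rw [hg x.2 (by omega), mul_zero]

theorem mem_orderIdeal_one {f : MvPowerSeries (Fin r) ℝ} :
    f ∈ orderIdeal r 1 ↔ MvPowerSeries.constantCoeff f = 0 := by
  constructor
  · intro h
    rw [← MvPowerSeries.coeff_zero_eq_constantCoeff_apply]
    exact h 0 (by simp)
  · intro h m hm
    rw [Nat.lt_one_iff, Finsupp.degree_eq_zero_iff] at hm
    rw [hm, MvPowerSeries.coeff_zero_eq_constantCoeff_apply, h]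

theorem pow_mem_orderIdeal {f : MvPowerSeries (Fin r) ℝ} (hf : f ∈ orderIdeal r 1) (n : ℕ) :
    f ^ n ∈ orderIdeal r n := by
  induction n with
  | zero => exact fun m hm => absurd hm (Nat.not_lt_zero _)
  | succ n ih =>
    rw [pow_succ]
    exact mul_mem_orderIdeal ih hf

theorem homPoly_eq_zero {d : ℕ} {f : MvPowerSeries (Fin r) ℝ} (hf : f ∈ orderIdeal r (d + 1)) :
    homPoly d f = 0 := by
  ext m
  rw [coeff_homPoly, MvPolynomial.coeff_zero]
  split_ifs with h
  · exact hf m (by omega)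
  · rfl

theorem homPoly_sub (d : ℕ) (f g : MvPowerSeries (Fin r) ℝ) :
    homPoly d (f - g) = homPoly d f - homPoly d g := by
  ext m
  simp only [coeff_homPoly, MvPolynomial.coeff_sub, map_sub]
  split_ifs <;> simp

theorem homPoly_congr {d : ℕ} {f g : MvPowerSeries (Fin r) ℝ} (h : f - g ∈ orderIdeal r (d + 1)) :
    homPoly d f = homPoly d g := by
  rw [← sub_eq_zero, ← homPoly_sub, homPoly_eq_zero h]

theorem homPoly_coe {d : ℕ} {P : MvPolynomial (Fin r) ℝ} (hP : P.IsHomogeneous d) :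
    homPoly d (P : MvPowerSeries (Fin r) ℝ) = P := by
  ext m
  rw [coeff_homPoly, MvPolynomial.coeff_coe]
  split_ifs with h
  · rfl
  · by_contra hne
    exact h (degree_of_coeff_ne_zero hP (Ne.symm hne))

theorem homPoly_pderiv (d : ℕ) (k : Fin r) (f : MvPowerSeries (Fin r) ℝ) :
    homPoly d (MvPowerSeries.pderiv ℝ k f) = MvPolynomial.pderiv k (homPoly (d + 1) f) := by
  ext m
  rw [coeff_homPoly, MvPolynomial.coeff_pderiv, coeff_homPoly, MvPowerSeries.coeff_pderiv]
  have h : (m + Finsupp.single k 1).degree = m.degree + 1 := by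
    rw [map_add, Finsupp.degree_single]
  rw [h]
  by_cases hm : m.degree = d
  · rw [if_pos hm, if_pos (by omega)]
  · rw [if_neg hm, if_neg (by omega), zero_mul]

/-- Integration raises the order by one: a nonconstant coefficient, multiplied by a positive
exponent, is a coefficient of some partial derivative. -/
theorem sub_const_mem_orderIdeal {d : ℕ} {f : MvPowerSeries (Fin r) ℝ}
    (hf : ∀ k, MvPowerSeries.pderiv ℝ k f ∈ orderIdeal r d)
    (h1 : MvPowerSeries.constantCoeff f = 1) : f - 1 ∈ orderIdeal r (d + 1) := by
  classical
  intro m hm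
  by_cases h0 : m = 0
  · subst h0
    rw [MvPowerSeries.coeff_zero_eq_constantCoeff_apply, map_sub, h1, map_one, sub_self]
  obtain ⟨k, hk⟩ := Finsupp.ne_iff.mp h0
  rw [Finsupp.coe_zero, Pi.zero_apply] at hk
  obtain ⟨n, rfl⟩ : ∃ n, m = n + Finsupp.single k 1 :=
    ⟨m - Finsupp.single k 1, (tsub_add_cancel_of_le (Finsupp.single_le_iff.mpr
      (Nat.one_le_iff_ne_zero.mpr hk))).symm⟩
  rw [map_add, Finsupp.degree_single] at hm
  have h := hf k n (by omega)
  rw [MvPowerSeries.coeff_pderiv] at h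
  rw [map_sub, (mul_eq_zero.mp h).resolve_right (by positivity), MvPowerSeries.coeff_one,
    if_neg h0, sub_zero]

/-! ### Exponential series -/

theorem constantCoeff_linForm (a : Fin (r + 1) → ℝ) :
    MvPowerSeries.constantCoeff (linForm a : MvPowerSeries (Fin r) ℝ) = 0 := by
  rw [← MvPowerSeries.coeff_zero_eq_constantCoeff_apply, MvPolynomial.coeff_coe,
    ← MvPolynomial.constantCoeff_eq]
  simp [linForm]

theorem linForm_isHomogeneous (a : Fin (r + 1) → ℝ) : (linForm a).IsHomogeneous 1 := by
  have h := formProd_isHomogeneous {a}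
  rwa [formProd_singleton, Multiset.card_singleton] at h

theorem coeff_expForm (a : Fin (r + 1) → ℝ) (m : Fin r →₀ ℕ) :
    MvPowerSeries.coeff m (expForm a) =
      ((m.degree.factorial : ℝ))⁻¹ * (linForm a ^ m.degree).coeff m := by
  have hs := PowerSeries.HasSubst.of_constantCoeff_zero (constantCoeff_linForm a)
  rw [expForm, PowerSeries.coeff_subst hs, finsum_eq_single _ m.degree]
  · rw [PowerSeries.coeff_exp, ← MvPolynomial.coe_pow, MvPolynomial.coeff_coe, smul_eq_mul]
    simp
  · intro n hn
    rw [← MvPolynomial.coe_pow, MvPolynomial.coeff_coe]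
    have h := (linForm_isHomogeneous a).pow n
    rw [one_mul] at h
    rw [by_contra fun h0 => hn (degree_of_coeff_ne_zero h h0).symm, smul_zero]

theorem constantCoeff_expForm (a : Fin (r + 1) → ℝ) :
    MvPowerSeries.constantCoeff (expForm a) = 1 := by
  rw [← MvPowerSeries.coeff_zero_eq_constantCoeff_apply, coeff_expForm]
  simp

theorem homPoly_expForm (d : ℕ) (a : Fin (r + 1) → ℝ) :
    homPoly d (expForm a) = ((d.factorial : ℝ))⁻¹ • linForm a ^ d := by
  ext m
  rw [coeff_homPoly, MvPolynomial.coeff_smul, smul_eq_mul]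
  split_ifs with h
  · rw [coeff_expForm, h]
  · have h1 := (linForm_isHomogeneous a).pow d
    rw [one_mul] at h1
    rw [by_contra fun h0 => h (degree_of_coeff_ne_zero h1 h0), mul_zero]

theorem pderiv_expForm (k : Fin r) (a : Fin (r + 1) → ℝ) :
    MvPowerSeries.pderiv ℝ k (expForm a) = MvPowerSeries.C (a k.castSucc) * expForm a := by
  ext m
  have hdeg : (m + Finsupp.single k 1).degree = m.degree + 1 := by
    rw [map_add, Finsupp.degree_single]
  rw [MvPowerSeries.coeff_pderiv, MvPowerSeries.coeff_C_mul, coeff_expForm, coeff_expForm, hdeg,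
    mul_assoc, ← MvPolynomial.coeff_pderiv, Derivation.leibniz_pow, pderiv_linForm,
    Nat.add_sub_cancel, smul_eq_mul, MvPolynomial.coeff_smul, mul_comm (linForm a ^ _),
    MvPolynomial.coeff_C_mul, Nat.factorial_succ, nsmul_eq_mul]
  have h1 : ((m.degree.factorial : ℕ) : ℝ) ≠ 0 := Nat.cast_ne_zero.mpr (Nat.factorial_ne_zero _)
  have h2 : ((m.degree : ℝ) + 1) ≠ 0 := by positivity
  push_cast
  field_simp

/-- All partial derivatives of f e^{-a} cancel, so it equals its constant term. This is uniqueness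
for the linear system that characterizes the exponential, from which the functional equation of
`expForm` follows. -/
theorem mul_expForm_neg_eq_one {f : MvPowerSeries (Fin r) ℝ} {a : Fin (r + 1) → ℝ}
    (hf : ∀ k, MvPowerSeries.pderiv ℝ k f = MvPowerSeries.C (a k.castSucc) * f)
    (h1 : MvPowerSeries.constantCoeff f = 1) : f * expForm (-a) = 1 := by
  refine MvPowerSeries.pderiv.ext (fun k => ?_) ?_
  · rw [Derivation.leibniz, hf, pderiv_expForm, MvPowerSeries.pderiv_one, smul_eq_mul, smul_eq_mul,
      Pi.neg_apply, map_neg]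
    ring
  · rw [map_mul, h1, constantCoeff_expForm, map_one, mul_one]

/-- The exponential series is determined by its logarithmic derivatives. -/
theorem eq_expForm {f : MvPowerSeries (Fin r) ℝ} {a : Fin (r + 1) → ℝ}
    (hf : ∀ k, MvPowerSeries.pderiv ℝ k f = MvPowerSeries.C (a k.castSucc) * f)
    (h1 : MvPowerSeries.constantCoeff f = 1) : f = expForm a := by
  have h2 := mul_expForm_neg_eq_one hf h1
  have h3 := mul_expForm_neg_eq_one (fun k => pderiv_expForm k a) (constantCoeff_expForm a)
  calc f = f * (expForm a * expForm (-a)) := by rw [h3, mul_one]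
    _ = (f * expForm (-a)) * expForm a := by ring
    _ = expForm a := by rw [h2, one_mul]

theorem expForm_add (a b : Fin (r + 1) → ℝ) : expForm (a + b) = expForm a * expForm b := by
  refine (eq_expForm (fun k => ?_) ?_).symm
  · rw [Derivation.leibniz, pderiv_expForm, pderiv_expForm, smul_eq_mul, smul_eq_mul, Pi.add_apply,
      map_add]
    ring
  · rw [map_mul, constantCoeff_expForm, constantCoeff_expForm, mul_one]

theorem expForm_congr {a b : Fin (r + 1) → ℝ} (h : ∀ k : Fin r, a k.castSucc = b k.castSucc) :
    expForm a = expForm b :=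
  eq_expForm (fun k => by rw [pderiv_expForm, h]) (constantCoeff_expForm a)

theorem expForm_zero : expForm (0 : Fin (r + 1) → ℝ) = 1 :=
  (eq_expForm (fun k => by simp) (by simp)).symm

theorem expForm_sum {ι : Type*} (s : Finset ι) (a : ι → Fin (r + 1) → ℝ) :
    expForm (∑ i ∈ s, a i) = ∏ i ∈ s, expForm (a i) := by
  classical
  induction s using Finset.induction_on with
  | empty => simp [expForm_zero]
  | insert i s hi ih => rw [Finset.sum_insert hi, Finset.prod_insert hi, expForm_add, ih]

/-- The exact value 1 of the constant term, and not merely invertibility, is what keeps the leading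
terms unchanged under the substitution. -/
theorem exists_one_sub_expForm_neg {α : Fin (r + 1) → ℝ} (hα : linForm α ≠ 0) :
    ∃ u : MvPowerSeries (Fin r) ℝ, MvPowerSeries.constantCoeff u = 1 ∧
      1 - expForm (-α) = u * (linForm α : MvPowerSeries (Fin r) ℝ) := by
  obtain ⟨u, -, hu⟩ := one_sub_expForm_neg α
  rw [mul_comm] at hu
  refine ⟨u, ?_, hu⟩
  -- In degree 1 the left side is the form α itself and the right side is u(0) times it.
  have h1 := congrArg (homPoly 1) hu
  have h2 : homPoly 1 (1 : MvPowerSeries (Fin r) ℝ) = 0 := by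
    classical
    ext m
    rw [coeff_homPoly, MvPowerSeries.coeff_one, MvPolynomial.coeff_zero]
    split_ifs with h h'
    · rw [h'] at h
      simp at h
    all_goals rfl
  have h3 : homPoly 0 u = MvPolynomial.C (MvPowerSeries.constantCoeff u) := by
    classical
    ext m
    rw [coeff_homPoly, MvPolynomial.coeff_C]
    by_cases h : m = 0
    · subst h
      simp
    · rw [if_neg (fun h' => h ((Finsupp.degree_eq_zero_iff m).mp h')), if_neg (Ne.symm h)]
  have h4 := homPoly_mul (d := 0) u (linForm_isHomogeneous α)
  rw [zero_add] at h4
  rw [homPoly_sub, homPoly_expForm, h2, h4, h3, Nat.factorial_one, Nat.cast_one, inv_one, one_smul,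
    pow_one, zero_sub, ← linFormHom_apply, map_neg, neg_neg, linFormHom_apply] at h1
  have h5 : (MvPolynomial.C (MvPowerSeries.constantCoeff u) - 1) * linForm α = 0 := by
    rw [sub_mul, ← h1, one_mul, sub_self]
  rw [mul_eq_zero, or_iff_left hα, sub_eq_zero, ← map_one MvPolynomial.C] at h5
  exact MvPolynomial.C_injective _ _ h5

end

noncomputable section

variable {r : ℕ}

/-! ### Change of variables -/

/-- `g` is the leading term of degree `d` of `f`. -/
def IsLeading (d : ℕ) (f g : MvPowerSeries (Fin r) ℝ) : Prop :=
  g ∈ orderIdeal r d ∧ f - g ∈ orderIdeal r (d + 1)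

theorem IsLeading.mem {d : ℕ} {f g : MvPowerSeries (Fin r) ℝ} (h : IsLeading d f g) :
    f ∈ orderIdeal r d := by
  have := Ideal.add_mem _ (orderIdeal_anti (Nat.le_succ d) h.2) h.1
  rwa [sub_add_cancel] at this

theorem IsLeading.mul {d e : ℕ} {f g f' g' : MvPowerSeries (Fin r) ℝ} (h : IsLeading d f g)
    (h' : IsLeading e f' g') : IsLeading (d + e) (f * f') (g * g') := by
  refine ⟨mul_mem_orderIdeal h.1 h'.1, ?_⟩
  have h1 := mul_mem_orderIdeal h.2 h'.mem
  have h2 := mul_mem_orderIdeal h.1 h'.2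
  rw [add_right_comm] at h1
  have h3 := Ideal.add_mem _ h1 h2
  convert h3 using 1
  ring

theorem IsLeading.one : IsLeading 0 (1 : MvPowerSeries (Fin r) ℝ) 1 :=
  ⟨fun m hm => absurd hm (Nat.not_lt_zero _), by simp⟩

theorem IsLeading.pow {d : ℕ} {f g : MvPowerSeries (Fin r) ℝ} (h : IsLeading d f g) (n : ℕ) :
    IsLeading (n * d) (f ^ n) (g ^ n) := by
  induction n with
  | zero => simpa using IsLeading.one
  | succ n ih =>
    rw [pow_succ, pow_succ, Nat.succ_mul]
    exact ih.mul h

theorem IsLeading.prod {ι : Type*} (s : Finset ι) {d : ι → ℕ}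
    {f g : ι → MvPowerSeries (Fin r) ℝ} (h : ∀ i ∈ s, IsLeading (d i) (f i) (g i)) :
    IsLeading (∑ i ∈ s, d i) (∏ i ∈ s, f i) (∏ i ∈ s, g i) := by
  classical
  induction s using Finset.induction_on with
  | empty => simpa using IsLeading.one
  | insert i s hi ih =>
    rw [Finset.sum_insert hi, Finset.prod_insert hi, Finset.prod_insert hi]
    exact (h i (Finset.mem_insert_self i s)).mul
      (ih fun j hj => h j (Finset.mem_insert_of_mem hj))

theorem isLeading_one_of_constantCoeff {f : MvPowerSeries (Fin r) ℝ}
    (hf : MvPowerSeries.constantCoeff f = 1) : IsLeading 0 f 1 :=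
  ⟨IsLeading.one.1, mem_orderIdeal_one.mpr (by rw [map_sub, hf, map_one, sub_self])⟩

theorem pderiv_aeval {Y w : Fin r → MvPowerSeries (Fin r) ℝ} {k : Fin r}
    (hY : ∀ j, MvPowerSeries.pderiv ℝ k (Y j) = if j = k then w k else 0)
    (P : MvPolynomial (Fin r) ℝ) : MvPowerSeries.pderiv ℝ k (MvPolynomial.aeval Y P) =
      MvPolynomial.aeval Y (MvPolynomial.pderiv k P) * w k := by
  induction P using MvPolynomial.induction_on with
  | C c =>
    rw [MvPolynomial.aeval_C, Derivation.map_algebraMap, MvPolynomial.pderiv_C, map_zero, zero_mul]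
  | add P Q hP hQ => simp only [map_add, hP, hQ, add_mul]
  | mul_X P i hP =>
    rw [map_mul, Derivation.leibniz, hP, MvPolynomial.aeval_X, hY, MvPolynomial.pderiv_mul,
      MvPolynomial.pderiv_X, map_add, map_mul, map_mul, MvPolynomial.aeval_X, smul_eq_mul,
      smul_eq_mul, Pi.single_apply]
    by_cases h : i = k
    · simp [h]
      ring
    · simp [h]
      ring

/-- The left side is Q² times the divergence of the vector field x G/Q. By Euler's formula that
divergence is G/Q times its degree plus r. -/
theorem sum_pderiv_X_mul {G Q : MvPolynomial (Fin r) ℝ} {e n : ℕ} (hG : G.IsHomogeneous e)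
    (hQ : Q.IsHomogeneous n) :
    ∑ k, (MvPolynomial.pderiv k (MvPolynomial.X k * G) * Q -
      MvPolynomial.X k * G * MvPolynomial.pderiv k Q) = ((e : ℝ) + r - n) • (G * Q) := by
  have h1 := hG.sum_X_mul_pderiv
  have h2 := hQ.sum_X_mul_pderiv
  have h3 : ∀ k : Fin r, MvPolynomial.pderiv k (MvPolynomial.X k * G) * Q -
      MvPolynomial.X k * G * MvPolynomial.pderiv k Q =
      G * Q + (MvPolynomial.X k * MvPolynomial.pderiv k G) * Q -
        G * (MvPolynomial.X k * MvPolynomial.pderiv k Q) := by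
    intro k
    rw [MvPolynomial.pderiv_mul, MvPolynomial.pderiv_X_self]
    ring
  rw [Finset.sum_congr rfl fun k _ => h3 k, Finset.sum_sub_distrib, Finset.sum_add_distrib,
    Finset.sum_const, Finset.card_univ, Fintype.card_fin, ← Finset.sum_mul, ← Finset.mul_sum, h1,
    h2, sub_smul, add_smul, Nat.cast_smul_eq_nsmul, Nat.cast_smul_eq_nsmul,
    Nat.cast_smul_eq_nsmul, smul_mul_assoc, mul_smul_comm]
  abel

/-- A diagonal change of variables `x_k ↦ Y_k(x_k)`, with derivatives `w_k`, which maps `Q` to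
`U Q`. -/
structure IsVarChange (Y w : Fin r → MvPowerSeries (Fin r) ℝ) (Q : MvPolynomial (Fin r) ℝ)
    (U : MvPowerSeries (Fin r) ℝ) : Prop where
  pderiv_Y : ∀ k j, MvPowerSeries.pderiv ℝ k (Y j) = if j = k then w k else 0
  pderiv_w : ∀ k j, j ≠ k → MvPowerSeries.pderiv ℝ k (w j) = 0
  leading : ∀ j, IsLeading 1 (Y j) (MvPowerSeries.X j)
  constantCoeff_w : ∀ j, MvPowerSeries.constantCoeff (w j) = 1
  aeval_eq : MvPolynomial.aeval Y Q = U * (Q : MvPowerSeries (Fin r) ℝ)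
  constantCoeff_U : MvPowerSeries.constantCoeff U = 1

/-- The image of the density `G dx_1 ⋯ dx_r / Q` under a change of variables, times `Q`. -/
def pullback (Y w : Fin r → MvPowerSeries (Fin r) ℝ) (U : MvPowerSeries (Fin r) ℝ)
    (G : MvPolynomial (Fin r) ℝ) : MvPowerSeries (Fin r) ℝ :=
  MvPolynomial.aeval Y G * (U⁻¹ * ∏ j, w j)

namespace IsVarChange

variable {Y w : Fin r → MvPowerSeries (Fin r) ℝ} {Q : MvPolynomial (Fin r) ℝ}
  {U : MvPowerSeries (Fin r) ℝ}

theorem isLeading_pullback (h : IsVarChange Y w Q U) (i : Fin r → ℕ) :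
    IsLeading (∑ j, i j) (pullback Y w U (∏ j, MvPolynomial.X j ^ i j))
      ((∏ j, MvPolynomial.X j ^ i j : MvPolynomial (Fin r) ℝ) : MvPowerSeries (Fin r) ℝ) := by
  have h1 : IsLeading (∑ j, i j)
      (MvPolynomial.aeval Y (∏ j, MvPolynomial.X j ^ i j : MvPolynomial (Fin r) ℝ))
      ((∏ j, MvPolynomial.X j ^ i j : MvPolynomial (Fin r) ℝ) : MvPowerSeries (Fin r) ℝ) := by
    have h2 := IsLeading.prod Finset.univ fun j _ => (h.leading j).pow (i j)
    simp only [mul_one] at h2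
    rw [map_prod, ← MvPolynomial.coeToMvPowerSeries.ringHom_apply, map_prod]
    simpa using h2
  have h3 : IsLeading 0 (U⁻¹ * ∏ j, w j) 1 := by
    refine isLeading_one_of_constantCoeff ?_
    rw [map_mul, map_prod, MvPowerSeries.constantCoeff_inv, h.constantCoeff_U, inv_one, one_mul]
    exact Finset.prod_eq_one fun j _ => h.constantCoeff_w j
  simpa [pullback] using h1.mul h3

theorem mul_inv (h : IsVarChange Y w Q U) : U * U⁻¹ = 1 :=
  MvPowerSeries.mul_inv_cancel _ (by rw [h.constantCoeff_U]; exact one_ne_zero)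

theorem pderiv_prod_erase (h : IsVarChange Y w Q U) (k : Fin r) :
    MvPowerSeries.pderiv ℝ k (∏ j ∈ Finset.univ.erase k, w j) = 0 := by
  classical
  have H : ∀ s : Finset (Fin r), k ∉ s → MvPowerSeries.pderiv ℝ k (∏ j ∈ s, w j) = 0 := by
    intro s
    induction s using Finset.induction_on with
    | empty => simp
    | insert i s hi ih =>
      intro hk
      rw [Finset.prod_insert hi, Derivation.leibniz,
        ih fun h' => hk (Finset.mem_insert_of_mem h'),
        h.pderiv_w k i fun h' => hk (h' ▸ Finset.mem_insert_self i s), smul_zero, smul_zero,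
        add_zero]
  exact H _ (Finset.notMem_erase k _)

/-- This is d commuting with the pullback of the (r-1)-form obtained from (F/Q) dx_1⋯dx_r by
omitting dx_k, cleared of the denominator Q². The substitution being diagonal, only the cofactor
∏_{j ≠ k} w_j appears, and it does not depend on x_k. The factor U⁻² comes from Q(Y)² = U²Q². -/
theorem pderiv_pullback (h : IsVarChange Y w Q U) (k : Fin r) (F : MvPolynomial (Fin r) ℝ) :
    MvPowerSeries.pderiv ℝ k
        (MvPolynomial.aeval Y F * (∏ j ∈ Finset.univ.erase k, w j) * U⁻¹) * Q -
      MvPolynomial.aeval Y F * (∏ j ∈ Finset.univ.erase k, w j) * U⁻¹ *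
        MvPowerSeries.pderiv ℝ k Q =
    MvPolynomial.aeval Y (MvPolynomial.pderiv k F * Q - F * MvPolynomial.pderiv k Q) *
      (∏ j, w j) * U⁻¹ ^ 2 := by
  have hF := pderiv_aeval (h.pderiv_Y k) F
  have hQ := pderiv_aeval (h.pderiv_Y k) Q
  rw [h.aeval_eq, Derivation.leibniz, smul_eq_mul, smul_eq_mul] at hQ
  rw [Derivation.leibniz, Derivation.leibniz, h.pderiv_prod_erase, MvPowerSeries.pderiv_inv', hF,
    map_sub, map_mul, map_mul, h.aeval_eq, ← Finset.mul_prod_erase _ w (Finset.mem_univ k)]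
  simp only [smul_eq_mul, mul_zero, zero_add]
  have hU := h.mul_inv
  set J := ∏ j ∈ Finset.univ.erase k, w j
  set A := MvPolynomial.aeval Y F
  set B := MvPolynomial.aeval Y (MvPolynomial.pderiv k F)
  set C := MvPolynomial.aeval Y (MvPolynomial.pderiv k Q)
  set V := U⁻¹
  -- The derivative of U is eliminated through the derivative of Q(Y) = UQ, and the remaining
  -- factors of U cancel against V = U⁻¹.
  linear_combination (-(A * J * V ^ 2)) * hQ +
    (A * J * V * MvPowerSeries.pderiv ℝ k Q - B * w k * J * V * Q) * hU

theorem sum_pderiv_pullback (h : IsVarChange Y w Q U) {G : MvPolynomial (Fin r) ℝ} {e n : ℕ}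
    (hG : G.IsHomogeneous e) (hQ : Q.IsHomogeneous n) :
    ∑ k, (MvPowerSeries.pderiv ℝ k (MvPolynomial.aeval Y (MvPolynomial.X k * G) *
          (∏ j ∈ Finset.univ.erase k, w j) * U⁻¹) * Q -
      MvPolynomial.aeval Y (MvPolynomial.X k * G) * (∏ j ∈ Finset.univ.erase k, w j) * U⁻¹ *
        MvPowerSeries.pderiv ℝ k Q) =
    ((e : ℝ) + r - n) • (pullback Y w U G * Q) := by
  rw [Finset.sum_congr rfl fun k _ => h.pderiv_pullback k _, ← Finset.sum_mul, ← Finset.sum_mul,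
    ← map_sum, sum_pderiv_X_mul hG hQ, map_smul, map_mul, h.aeval_eq, smul_mul_assoc,
    smul_mul_assoc, pullback]
  congr 1
  have hU := h.mul_inv
  linear_combination (MvPolynomial.aeval Y G * Q * (∏ j, w j) * U⁻¹) * hU

end IsVarChange

theorem prod_X_pow_isHomogeneous (i : Fin r → ℕ) :
    (∏ j, MvPolynomial.X j ^ i j : MvPolynomial (Fin r) ℝ).IsHomogeneous (∑ j, i j) := by
  refine MvPolynomial.IsHomogeneous.prod _ _ _ fun j _ => ?_
  simpa using (MvPolynomial.isHomogeneous_X ℝ j).pow (i j)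

theorem homPoly_sum {ι : Type*} (d : ℕ) (s : Finset ι) (f : ι → MvPowerSeries (Fin r) ℝ) :
    homPoly d (∑ i ∈ s, f i) = ∑ i ∈ s, homPoly d (f i) := by
  ext m
  simp only [coeff_homPoly, MvPolynomial.coeff_sum, map_sum]
  split_ifs <;> simp

theorem homPoly_smul (d : ℕ) (c : ℝ) (f : MvPowerSeries (Fin r) ℝ) :
    homPoly d (c • f) = c • homPoly d f := by
  ext m
  simp only [coeff_homPoly, MvPolynomial.coeff_smul, MvPowerSeries.coeff_smul]
  split_ifs <;> simp

/-! ### Invariance of the total residue under changes of variables -/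

section Residue

variable {D : Set (Fin (r + 1) → ℝ)} (hD : D ⊆ posRoots r)
  (hspan : Submodule.span ℝ (symm D) = rootSpace r) {l : Multiset (Fin (r + 1) → ℝ)}
  (hl : ∀ α ∈ l, α ∈ symm D)

theorem fracRes_eq_zero {d : ℕ} {P : MvPowerSeries (Fin r) ℝ} (hP : P ∈ orderIdeal r (d + 1)) :
    fracRes hD hspan d l hl P = 0 := by
  rw [fracRes_apply, homPoly_eq_zero hP, toRat_zero, zero_div]
  exact tresRat_of_mem_derivSpace hD (Submodule.zero_mem _)

/-- Since G/Q has degree e - n < -r, Euler's formula makes it a nonzero multiple of a divergence,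
and so is its pullback. The part of degree -r of that divergence is again a divergence, now of
elements of R_Δ. -/
theorem div_mem_derivSpace_of_lt {Y w : Fin r → MvPowerSeries (Fin r) ℝ}
    {U : MvPowerSeries (Fin r) ℝ} (h : IsVarChange Y w (formProd l) U) {d e : ℕ}
    (hd : d + r = Multiset.card l) (he : e < d) {G : MvPolynomial (Fin r) ℝ}
    (hG : G.IsHomogeneous e) (hQ0 : formProd l ≠ 0) (hl : ∀ α ∈ l, α ∈ symm D) :
    toRat (homPoly d (pullback Y w U G)) / toRat (formProd l) ∈ derivSpace (symm D) := by
  set Q := formProd l with hQdef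
  set n := Multiset.card l with hn
  have hQ : Q.IsHomogeneous n := formProd_isHomogeneous l
  let H : Fin r → MvPowerSeries (Fin r) ℝ := fun k =>
    MvPolynomial.aeval Y (MvPolynomial.X k * G) * (∏ j ∈ Finset.univ.erase k, w j) * U⁻¹
  have h1 := congrArg (homPoly (d + n)) (h.sum_pderiv_pullback hG hQ)
  rw [homPoly_sum, homPoly_smul, homPoly_mul _ hQ] at h1
  have h2 : ∀ k, homPoly (d + n)
      (MvPowerSeries.pderiv ℝ k (H k) * (Q : MvPowerSeries (Fin r) ℝ) -
        H k * MvPowerSeries.pderiv ℝ k (Q : MvPowerSeries (Fin r) ℝ)) =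
      MvPolynomial.pderiv k (homPoly (d + 1) (H k)) * Q -
        homPoly (d + 1) (H k) * MvPolynomial.pderiv k Q := by
    intro k
    -- The degree d + n is split as (d + 1) + (n - 1) because ∂_k Q has degree n - 1. Here n ≥ 1, as
    -- e < d forces d > 0.
    rw [homPoly_sub, homPoly_mul _ hQ, homPoly_pderiv, MvPowerSeries.pderiv_coe,
      show d + n = (d + 1) + (n - 1) by omega, homPoly_mul _ hQ.pderiv]
  have h3 : ((e : ℝ) + r - n) • (homPoly d (pullback Y w U G) * Q) =
      ∑ k, (MvPolynomial.pderiv k (homPoly (d + 1) (H k)) * Q -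
        homPoly (d + 1) (H k) * MvPolynomial.pderiv k Q) :=
    h1.symm.trans (Finset.sum_congr rfl fun k _ => h2 k)
  have hc : ((e : ℝ) + r - n) ≠ 0 := by
    have : ((d : ℝ) + r) = n := by exact_mod_cast hd
    have : (e : ℝ) < d := by exact_mod_cast he
    linarith
  have hQ' : toRat Q ≠ 0 := toRat_eq_zero.not.mpr hQ0
  have h4 : ((e : ℝ) + r - n) • (toRat (homPoly d (pullback Y w U G)) / toRat Q) =
      ∑ k, ratDeriv k (toRat (homPoly (d + 1) (H k)) / toRat Q) := by
    rw [Finset.sum_congr rfl fun k _ => ratDeriv_div k _ _, ← Finset.sum_div, ← toRat_sum, ← h3,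
      toRat_smul, toRat_mul, smul_div_assoc, pow_two, mul_div_mul_right _ _ hQ']
  refine (Submodule.smul_mem_iff _ hc).mp ?_
  rw [h4]
  exact Submodule.sum_mem _ fun k _ => ratDeriv_div_mem_derivSpace k _ hl

/-- Below degree d the pullback is exact in degree -r, in degree d only its leading term x^i
contributes, and above d it has no part of degree -r. The pullback thus has the same total residue
as the original density. -/
theorem fracRes_pullback {Y w : Fin r → MvPowerSeries (Fin r) ℝ} {U : MvPowerSeries (Fin r) ℝ}
    (h : IsVarChange Y w (formProd l) U) {d : ℕ} (hd : d + r = Multiset.card l)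
    (i : Fin r → ℕ) :
    fracRes hD hspan d l hl (pullback Y w U (∏ j, MvPolynomial.X j ^ i j)) =
      if ∑ j, i j = d then tresRat (symm D)
        (toRat (∏ j, MvPolynomial.X j ^ i j) / toRat (formProd l)) else 0 := by
  have hlead := h.isLeading_pullback i
  rcases lt_trichotomy (∑ j, i j) d with he | he | he
  · rw [if_neg he.ne, fracRes_apply]
    exact tresRat_of_mem_derivSpace hD (div_mem_derivSpace_of_lt h hd he
      (prod_X_pow_isHomogeneous i) (formProd_ne_zero hD hl) hl)
  · rw [if_pos he, fracRes_apply]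
    rw [he] at hlead
    rw [homPoly_congr hlead.2, homPoly_coe (he ▸ prod_X_pow_isHomogeneous i)]
  · rw [if_neg he.ne']
    exact fracRes_eq_zero hD hspan hl (orderIdeal_anti he hlead.mem)

end Residue

end

noncomputable section

variable {r : ℕ}

/-! ### Binomial expansions of exponentials -/

/-- The coefficients `c (c - ε) ⋯ (c - (k - 1) ε) / k!` of the series `(1 + ε y)^{c / ε}`. -/
def stepBinom (ε c : ℝ) (k : ℕ) : ℝ :=
  (∏ m ∈ Finset.range k, (c - ε * m)) / k.factorial

theorem stepBinom_zero (ε c : ℝ) : stepBinom ε c 0 = 1 := by simp [stepBinom]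

theorem stepBinom_succ (ε c : ℝ) (k : ℕ) :
    ((k : ℝ) + 1) * stepBinom ε c (k + 1) = (c - ε * k) * stepBinom ε c k := by
  have h1 : ((k.factorial : ℕ) : ℝ) ≠ 0 := Nat.cast_ne_zero.mpr (Nat.factorial_ne_zero _)
  have h2 : ((k : ℝ) + 1) ≠ 0 := by positivity
  rw [stepBinom, stepBinom, Finset.prod_range_succ, Nat.factorial_succ]
  push_cast
  field_simp

theorem stepBinom_one (c : ℝ) (k : ℕ) : stepBinom 1 c k = binom c k := by
  simp [stepBinom, binom]

theorem stepBinom_neg_one (c : ℝ) (k : ℕ) : stepBinom (-1) c k = risingBinom c k := by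
  simp [stepBinom, risingBinom]

/-- The full series (1 + εY)^{c/ε} satisfies Df = c f. For the truncation the recursion of the
coefficients telescopes and leaves only a term in Y^d. -/
theorem derivation_sum_stepBinom {A : Type*} [CommRing A] [Algebra ℝ A] (D : Derivation ℝ A A)
    (ε c : ℝ) {Y : A} (hY : D Y = 1 + ε • Y) (d : ℕ) :
    D (∑ i ∈ Finset.range (d + 1), stepBinom ε c i • Y ^ i) =
      c • (∑ i ∈ Finset.range (d + 1), stepBinom ε c i • Y ^ i) -
        (((d : ℝ) + 1) * stepBinom ε c (d + 1)) • Y ^ d := by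
  induction d with
  | zero =>
    have h := stepBinom_succ ε c 0
    simp only [Nat.cast_zero, zero_add, one_mul, mul_zero, sub_zero, stepBinom_zero, mul_one] at h
    simp [stepBinom_zero, h]
  | succ d ih =>
    rw [Finset.sum_range_succ, map_add, ih, Derivation.map_smul, Derivation.leibniz_pow, hY,
      Nat.add_sub_cancel, smul_add]
    have h := stepBinom_succ ε c (d + 1)
    rw [h]
    simp only [nsmul_eq_mul, smul_eq_mul]
    simp only [Algebra.smul_def, map_mul, map_sub, map_add, map_one,
      map_natCast, Nat.cast_add, Nat.cast_one]
    ring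

/-- The exponential `e^{ε x_i}`, where `x_{r+1} = 0`. -/
def expVar (ε : ℝ) (i : Fin (r + 1)) : MvPowerSeries (Fin r) ℝ := expForm (ε • Pi.single i 1)

theorem pderiv_expVar (ε : ℝ) (i : Fin (r + 1)) (k : Fin r) :
    MvPowerSeries.pderiv ℝ k (expVar ε i) = if i = k.castSucc then ε • expVar ε i else 0 := by
  rw [expVar, pderiv_expForm, MvPowerSeries.smul_eq_C_mul]
  by_cases h : i = k.castSucc
  · subst h
    simp
  · simp [h, Ne.symm h]

theorem constantCoeff_expVar (ε : ℝ) (i : Fin (r + 1)) :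
    MvPowerSeries.constantCoeff (expVar ε i) = 1 := constantCoeff_expForm _

/-- The new variable `ε (e^{ε x_i} - 1)`, where `ε = ±1`. -/
def newVar (ε : ℝ) (i : Fin (r + 1)) : MvPowerSeries (Fin r) ℝ := ε • (expVar ε i - 1)

theorem newVar_last (ε : ℝ) : newVar ε (Fin.last r) = 0 := by
  have h : expVar ε (Fin.last r) = 1 := by
    rw [expVar, ← expForm_zero]
    exact expForm_congr fun k => by simp [Fin.castSucc_ne_last]
  rw [newVar, h, sub_self, smul_zero]

theorem constantCoeff_newVar (ε : ℝ) (i : Fin (r + 1)) :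
    MvPowerSeries.constantCoeff (newVar ε i) = 0 := by
  rw [newVar, MvPowerSeries.smul_eq_C_mul, map_mul, map_sub, constantCoeff_expVar, map_one,
    sub_self, mul_zero]

theorem pderiv_newVar {ε : ℝ} (hε : ε * ε = 1) (i : Fin (r + 1)) (k : Fin r) :
    MvPowerSeries.pderiv ℝ k (newVar ε i) = if i = k.castSucc then expVar ε i else 0 := by
  rw [newVar, Derivation.map_smul, map_sub, pderiv_expVar, MvPowerSeries.pderiv_one, sub_zero]
  split_ifs
  · rw [smul_smul, hε, one_smul]
  · rw [smul_zero]

theorem expVar_eq {ε : ℝ} (hε : ε * ε = 1) (i : Fin (r + 1)) :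
    expVar ε i = 1 + ε • newVar ε i := by
  rw [newVar, smul_smul, hε, one_smul, add_sub_cancel]

/-- Multiplying the truncated binomial series by e^{-c x_j} gives a series whose derivatives have
order at least d and whose constant term is 1. It is therefore 1 up to order d + 1, and multiplying
back by e^{c x_j} gives the claim. -/
theorem expForm_single_sub_mem {ε : ℝ} (hε : ε * ε = 1) (c : ℝ) (j : Fin r) (d : ℕ) :
    expForm (c • Pi.single j.castSucc 1) -
      ∑ i ∈ Finset.range (d + 1), stepBinom ε c i • newVar ε j.castSucc ^ i ∈
        orderIdeal r (d + 1) := by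
  set Y := newVar ε j.castSucc with hY
  set f := ∑ i ∈ Finset.range (d + 1), stepBinom ε c i • Y ^ i with hf
  set a : Fin (r + 1) → ℝ := c • Pi.single j.castSucc 1 with ha
  have hY0 : Y ∈ orderIdeal r 1 := mem_orderIdeal_one.mpr (constantCoeff_newVar _ _)
  have hder : ∀ k, MvPowerSeries.pderiv ℝ k (f * expForm (-a)) ∈ orderIdeal r d := by
    intro k
    rw [Derivation.leibniz, pderiv_expForm, smul_eq_mul, smul_eq_mul]
    by_cases hk : k = j
    · subst hk
      rw [derivation_sum_stepBinom _ ε c (by rw [hY, pderiv_newVar hε, if_pos rfl, expVar_eq hε]),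
        ← hf]
      have h1 : (-a) k.castSucc = -c := by simp [ha]
      rw [h1]
      have h2 := Ideal.mul_mem_left (orderIdeal r d)
        (-(MvPowerSeries.C (((d : ℝ) + 1) * stepBinom ε c (d + 1)) * expForm (-a)))
        (pow_mem_orderIdeal hY0 d)
      convert h2 using 1
      rw [MvPowerSeries.smul_eq_C_mul, MvPowerSeries.smul_eq_C_mul, map_neg]
      ring
    · have h1 : MvPowerSeries.pderiv ℝ k f = 0 := by
        rw [hf, map_sum]
        refine Finset.sum_eq_zero fun i _ => ?_
        rw [Derivation.map_smul, Derivation.leibniz_pow, hY, pderiv_newVar hε,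
          if_neg fun h => hk (Fin.castSucc_injective _ h).symm, smul_zero, smul_zero, smul_zero]
      have h2 : (-a) k.castSucc = 0 := by simp [ha, hk]
      rw [h1, h2, map_zero]
      simp
  have hf0 : MvPowerSeries.constantCoeff f = 1 := by
    rw [hf, map_sum, Finset.sum_range_succ']
    have h1 : MvPowerSeries.constantCoeff Y = 0 := constantCoeff_newVar _ _
    simp [MvPowerSeries.smul_eq_C_mul, h1, stepBinom_zero]
  have h1 := sub_const_mem_orderIdeal hder (by
    rw [map_mul, hf0, constantCoeff_expForm, mul_one])
  have h2 : expForm a * expForm (-a) = 1 := by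
    rw [← expForm_add, add_neg_cancel, expForm_zero]
  have h3 := Ideal.mul_mem_left _ (-expForm a) h1
  convert h3 using 1
  linear_combination f * h2

theorem prod_sub_prod_mem {ι A : Type*} [CommRing A] (I : Ideal A) (s : Finset ι) (f g : ι → A)
    (h : ∀ i ∈ s, f i - g i ∈ I) : ∏ i ∈ s, f i - ∏ i ∈ s, g i ∈ I := by
  rw [← Ideal.Quotient.eq, map_prod, map_prod]
  exact Finset.prod_congr rfl fun i hi => Ideal.Quotient.eq.mpr (h i hi)

/-! ### The change of variables for products of roots -/

theorem isLeading_newVar {ε : ℝ} (hε : ε * ε = 1) (j : Fin r) :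
    IsLeading 1 (newVar ε j.castSucc) (MvPowerSeries.X j) := by
  refine ⟨mem_orderIdeal_one.mpr (by simp), ?_⟩
  have h := sub_const_mem_orderIdeal (d := 1)
    (f := newVar ε j.castSucc - MvPowerSeries.X j + 1) (fun k => ?_) ?_
  · simpa using h
  · rw [map_add, map_sub, pderiv_newVar hε, MvPowerSeries.pderiv_one, add_zero, mem_orderIdeal_one]
    by_cases hk : j = k
    · subst hk
      rw [if_pos rfl, MvPowerSeries.pderiv_X_self, map_sub, constantCoeff_expVar, map_one, sub_self]
    · rw [if_neg fun h => hk (Fin.castSucc_injective _ h), MvPowerSeries.pderiv_X_of_ne hk,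
        sub_zero, map_zero]
  · rw [map_add, map_sub, constantCoeff_newVar, map_one]
    simp

/-- The convention x_{r+1} = 0 matches Y_{r+1} = 0, so roots ending at the last vertex need no
separate treatment. -/
theorem aeval_newVar_root (ε : ℝ) (i j : Fin (r + 1)) :
    MvPolynomial.aeval (fun k : Fin r => newVar ε k.castSucc) (linForm (root i j)) =
      newVar ε i - newVar ε j := by
  rw [← sum_root_smul _ (newVar_last ε), linForm, map_sum]
  refine Finset.sum_congr rfl fun k _ => ?_
  rw [← MvPolynomial.smul_eq_C_mul, map_smul, MvPolynomial.aeval_X]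

theorem formProd_map {N : ℕ} (Φ : Fin N → Fin (r + 1) → ℝ) :
    formProd (Finset.univ.val.map Φ) = ∏ k, linForm (Φ k) := by
  rw [formProd, Multiset.map_map]
  rfl

/-- The exponential e^{h_k} and the unit u_k = (1 - e^{-α_k})/α_k are the two parts of the factor by
which the substitution multiplies the root α_k. -/
theorem isVarChange_newVar {N : ℕ} {ε : ℝ} (hε : ε * ε = 1) {Φ h : Fin N → Fin (r + 1) → ℝ}
    {p q : Fin N → Fin (r + 1)} (hΦ : ∀ k, Φ k = root (p k) (q k))
    (hh : ∀ k, newVar ε (p k) - newVar ε (q k) = expForm (h k) * (1 - expForm (-Φ k)))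
    {u : Fin N → MvPowerSeries (Fin r) ℝ} (hu0 : ∀ k, MvPowerSeries.constantCoeff (u k) = 1)
    (hu : ∀ k, 1 - expForm (-Φ k) = u k * (linForm (Φ k) : MvPowerSeries (Fin r) ℝ)) :
    IsVarChange (fun j => newVar ε j.castSucc) (fun j => expVar ε j.castSucc)
      (formProd (Finset.univ.val.map Φ)) (∏ k, expForm (h k) * u k) where
  pderiv_Y k j := by
    rw [pderiv_newVar hε]
    simp only [Fin.castSucc_inj]
    split_ifs with h1
    · rw [h1]
    · rfl
  pderiv_w k j hj := by
    rw [pderiv_expVar, if_neg fun h => hj (Fin.castSucc_injective _ h)]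
  leading := isLeading_newVar hε
  constantCoeff_w j := constantCoeff_expVar _ _
  aeval_eq := by
    rw [formProd_map, map_prod, ← MvPolynomial.coeToMvPowerSeries.ringHom_apply, map_prod,
      ← Finset.prod_mul_distrib]
    refine Finset.prod_congr rfl fun k _ => ?_
    rw [MvPolynomial.coeToMvPowerSeries.ringHom_apply, mul_assoc, ← hu, ← hh, ← aeval_newVar_root,
      ← hΦ]
  constantCoeff_U := by
    rw [map_prod]
    exact Finset.prod_eq_one fun k _ => by rw [map_mul, constantCoeff_expForm, hu0, mul_one]

theorem kFun_eq {N : ℕ} {Φ : Fin N → Fin (r + 1) → ℝ} {u : Fin N → MvPowerSeries (Fin r) ℝ}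
    (hu0 : ∀ k, MvPowerSeries.constantCoeff (u k) = 1)
    (hu : ∀ k, 1 - expForm (-Φ k) = u k * (linForm (Φ k) : MvPowerSeries (Fin r) ℝ))
    (a : Fin r → ℝ) : kFun Φ a = toHat (expForm (bold a) * (∏ k, u k)⁻¹) /
      toHat (formProd (Finset.univ.val.map Φ) : MvPowerSeries (Fin r) ℝ) := by
  have hU : (∏ k, u k) * (∏ k, u k)⁻¹ = 1 := by
    refine MvPowerSeries.mul_inv_cancel _ ?_
    rw [map_prod, Finset.prod_eq_one fun k _ => hu0 k]
    exact one_ne_zero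
  have hU' : toHat (∏ k, u k) * toHat (∏ k, u k)⁻¹ = 1 := by
    rw [toHat, toHat, ← map_mul, hU, map_one]
  have h1 : ∏ k, toHat (1 - expForm (-Φ k)) = toHat (∏ k, u k) *
      toHat (formProd (Finset.univ.val.map Φ) : MvPowerSeries (Fin r) ℝ) := by
    rw [toHat_formProd_map, toHat, map_prod, ← Finset.prod_mul_distrib]
    refine Finset.prod_congr rfl fun k _ => ?_
    rw [hu, toHat, toHat, map_mul]
  have h2 : toHat (expForm (bold a) * (∏ k, u k)⁻¹) =
      toHat (expForm (bold a)) * (toHat (∏ k, u k))⁻¹ := by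
    rw [← eq_inv_of_mul_eq_one_right hU']
    exact map_mul _ _ _
  rw [kFun, h1, h2, div_mul_eq_div_div, div_eq_mul_inv (toHat (expForm (bold a)))]

theorem fCoeff_eq {N : ℕ} (Δ : Set (Fin (r + 1) → ℝ)) (Φ : Fin N → Fin (r + 1) → ℝ)
    (i : Fin r → ℕ) : fCoeff Δ Φ i = tresRat Δ (toRat (∏ j, MvPolynomial.X j ^ i j) /
      toRat (formProd (Finset.univ.val.map Φ))) := by
  rw [fCoeff, formProd_map, toRat_prod (s := Finset.univ) (f := fun k => linForm (Φ k))]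

/-! ### The expansions of J and K -/

section Formulas

variable {N : ℕ} {D : Set (Fin (r + 1) → ℝ)} {Φ : Fin N → Fin (r + 1) → ℝ}

theorem span_symm (hD : D ⊆ posRoots r) (hΦ : ∀ k, Φ k ∈ D)
    (hspan : Submodule.span ℝ (Set.range Φ) = rootSpace r) :
    Submodule.span ℝ (symm D) = rootSpace r := by
  refine le_antisymm (Submodule.span_le.mpr ?_) ?_
  · have hpos : ∀ α ∈ D, α ∈ rootSpace r := by
      intro α hα
      obtain ⟨i, j, -, rfl⟩ := hD hα
      exact root_mem_rootSpace i j
    rintro α (hα | hα)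
    · exact hpos α hα
    · have h := Submodule.neg_mem _ (hpos _ hα)
      rwa [neg_neg] at h
  · rw [← hspan]
    refine Submodule.span_mono ?_
    rintro _ ⟨k, rfl⟩
    exact Or.inl (hΦ k)

/-- This makes the truncated difference N - r the true degree. -/
theorem rank_le_of_span (hspan : Submodule.span ℝ (Set.range Φ) = rootSpace r) : r ≤ N := by
  have h := finrank_range_le_card (R := ℝ) Φ
  rwa [Set.finrank, hspan, finrank_rootSpace, Fintype.card_fin] at h

theorem mem_map_symm (hΦ : ∀ k, Φ k ∈ D) : ∀ α ∈ Finset.univ.val.map Φ, α ∈ symm D := by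
  intro α hα
  obtain ⟨k, -, rfl⟩ := Multiset.mem_map.mp hα
  exact Or.inl (hΦ k)

theorem J_eq_sum (hD : D ⊆ posRoots r) (hΦ : ∀ k, Φ k ∈ D)
    (hspan : Submodule.span ℝ (Set.range Φ) = rootSpace r) (a : Fin r → ℝ) :
    J (symm D) Φ a = ∑ i ∈ Finset.piAntidiag (Finset.univ : Finset (Fin r)) (N - r),
      (∏ k, a k ^ i k / ((i k).factorial : ℝ)) • fCoeff (symm D) Φ i := by
  have hs := span_symm hD hΦ hspan
  have hl := mem_map_symm hΦ
  have hcard : Multiset.card (Finset.univ.val.map Φ) = N := by simp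
  rw [J, jFun, ← toHat_formProd_map, tres_div_formProd hD hs hl
    (by rw [hcard]; exact rank_le_of_span hspan), hcard]
  have hhom : ∀ i ∈ Finset.piAntidiag (Finset.univ : Finset (Fin r)) (N - r),
      (∏ j, MvPolynomial.X j ^ i j : MvPolynomial (Fin r) ℝ).IsHomogeneous (N - r) := by
    intro i hi
    rw [← (Finset.mem_piAntidiag.mp hi).1]
    exact prod_X_pow_isHomogeneous i
  have hexp : homPoly (N - r) (expForm (bold a)) =
      homPoly (N - r) (∑ i ∈ Finset.piAntidiag (Finset.univ : Finset (Fin r)) (N - r),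
        (∏ k, a k ^ i k / ((i k).factorial : ℝ)) •
          ((∏ j, MvPolynomial.X j ^ i j : MvPolynomial (Fin r) ℝ) : MvPowerSeries (Fin r) ℝ)) := by
    have hlin : linForm (bold a) = ∑ k, MvPolynomial.C (a k) * MvPolynomial.X k := by
      simp [linForm, bold]
    rw [homPoly_expForm, homPoly_sum, hlin, Finset.sum_pow_eq_sum_piAntidiag, Finset.smul_sum]
    refine Finset.sum_congr rfl fun i hi => ?_
    rw [homPoly_smul, homPoly_coe (hhom i hi)]
    simp only [mul_pow, Finset.prod_mul_distrib, ← map_pow, ← map_prod]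
    rw [← MvPolynomial.smul_eq_C_mul, ← nsmul_eq_mul, ← Nat.cast_smul_eq_nsmul ℝ, smul_smul,
      smul_smul]
    congr 1
    -- The multinomial coefficient divided by (N-r)! is the product of the 1/i_k!.
    have h1 := Nat.multinomial_spec Finset.univ i
    rw [(Finset.mem_piAntidiag.mp hi).1] at h1
    have h2 : (((N - r).factorial : ℕ) : ℝ) =
        (∏ k, ((i k).factorial : ℝ)) * (Nat.multinomial Finset.univ i : ℝ) := by
      rw [← h1]
      push_cast
      rfl
    have h3 : (∏ k, ((i k).factorial : ℝ)) ≠ 0 :=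
      Finset.prod_ne_zero_iff.mpr fun k _ => Nat.cast_ne_zero.mpr (Nat.factorial_ne_zero _)
    have h4 : (Nat.multinomial Finset.univ i : ℝ) ≠ 0 := by
      intro h0
      rw [h0, mul_zero] at h2
      exact Nat.cast_ne_zero.mpr (Nat.factorial_ne_zero (N - r)) h2
    rw [Finset.prod_div_distrib, h2]
    field_simp
  rw [fracRes_apply, hexp, ← fracRes_apply hD hs _ _ hl, map_sum]
  refine Finset.sum_congr rfl fun i hi => ?_
  rw [map_smul, fracRes_apply, homPoly_coe (hhom i hi), fCoeff_eq]

/-- Both formulas for K come from this one, with ε = 1 or ε = -1. The condition on c says that the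
numerator e^a, times the exponentials e^{h_k} released by the roots, equals ∏ e^{c_j x_j} times the
Jacobian e^{ε∑x_j}. -/
theorem K_eq_sum (hD : D ⊆ posRoots r) (hΦ : ∀ k, Φ k ∈ D)
    (hspan : Submodule.span ℝ (Set.range Φ) = rootSpace r) {ε : ℝ} (hε : ε * ε = 1)
    {p q : Fin N → Fin (r + 1)} (hpq : ∀ k, Φ k = root (p k) (q k))
    {h : Fin N → Fin (r + 1) → ℝ}
    (hh : ∀ k, newVar ε (p k) - newVar ε (q k) = expForm (h k) * (1 - expForm (-Φ k)))
    (a c : Fin r → ℝ) (hc : ∀ j, a j + ∑ k, h k j.castSucc = c j + ε) :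
    K (symm D) Φ a = ∑ i ∈ Finset.piAntidiag (Finset.univ : Finset (Fin r)) (N - r),
      (∏ k, stepBinom ε (c k) (i k)) • fCoeff (symm D) Φ i := by
  have hs := span_symm hD hΦ hspan
  have hl := mem_map_symm hΦ
  have hcard : Multiset.card (Finset.univ.val.map Φ) = N := by simp
  have hrN := rank_le_of_span hspan
  choose u hu0 hu using fun k =>
    exists_one_sub_expForm_neg (linForm_ne_zero hD (Or.inl (hΦ k) : Φ k ∈ symm D))
  have hV := isVarChange_newVar hε hpq hh hu0 hu
  rw [K, kFun_eq hu0 hu, tres_div_formProd hD hs hl (by rw [hcard]; exact hrN), hcard]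
  set U := ∏ k, expForm (h k) * u k with hUdef
  set d := N - r with hd
  -- The numerator is put in the form of a pullback: a function of the new variables times U⁻¹ and
  -- the Jacobian.
  have hnum : expForm (bold a) * (∏ k, u k)⁻¹ =
      (∏ j, expForm (c j • Pi.single j.castSucc (1 : ℝ))) *
        (U⁻¹ * ∏ j : Fin r, expVar ε j.castSucc) := by
    have h1 : (∏ k, u k) * (∏ k, u k)⁻¹ = 1 := by
      refine MvPowerSeries.mul_inv_cancel _ ?_
      rw [map_prod, Finset.prod_eq_one fun k _ => hu0 k]
      exact one_ne_zero
    have h2 := hV.mul_inv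
    have h3 : expForm (bold a) * ∏ k, expForm (h k) =
        (∏ j, expForm (c j • Pi.single j.castSucc (1 : ℝ))) *
          ∏ j : Fin r, expVar ε j.castSucc := by
      simp only [expVar]
      rw [← expForm_sum, ← expForm_sum, ← expForm_sum, ← expForm_add, ← expForm_add]
      refine expForm_congr fun j => ?_
      have h4 := hc j
      simp [bold, Pi.single_apply, Fin.castSucc_inj]
      linarith
    have h5 : U = (∏ k, expForm (h k)) * ∏ k, u k := Finset.prod_mul_distrib
    calc expForm (bold a) * (∏ k, u k)⁻¹
        = expForm (bold a) * (∏ k, u k)⁻¹ * (U * U⁻¹) := by rw [h2, mul_one]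
      _ = (expForm (bold a) * ∏ k, expForm (h k)) * ((∏ k, u k) * (∏ k, u k)⁻¹) * U⁻¹ := by
          rw [h5]
          ring
      _ = _ := by
          rw [h3, h1]
          ring
  -- Errors of order d + 1 are invisible to the residue, so each exponential may be cut off after
  -- the power d of its variable. The product then runs over a box of exponents that contains all
  -- those of total degree d.
  have htrunc := prod_sub_prod_mem (orderIdeal r (d + 1)) Finset.univ _ _ fun j _ =>
    expForm_single_sub_mem hε (c j) j d
  have hexpand : ∏ j : Fin r, ∑ i ∈ Finset.range (d + 1),
      stepBinom ε (c j) i • newVar ε j.castSucc ^ i =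
      ∑ i ∈ Fintype.piFinset fun _ : Fin r => Finset.range (d + 1),
        (∏ j, stepBinom ε (c j) (i j)) • MvPolynomial.aeval (fun j : Fin r => newVar ε j.castSucc)
          (∏ j, MvPolynomial.X j ^ i j : MvPolynomial (Fin r) ℝ) := by
    rw [Finset.prod_univ_sum]
    refine Finset.sum_congr rfl fun i _ => ?_
    rw [map_prod, Finset.prod_smul]
    simp
  have hpull : fracRes hD hs d _ hl (expForm (bold a) * (∏ k, u k)⁻¹) =
      ∑ i ∈ Fintype.piFinset fun _ : Fin r => Finset.range (d + 1),
        (∏ j, stepBinom ε (c j) (i j)) • fracRes hD hs d _ hl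
          (pullback (fun j : Fin r => newVar ε j.castSucc) (fun j : Fin r => expVar ε j.castSucc) U
            (∏ j, MvPolynomial.X j ^ i j)) := by
    rw [hnum, ← sub_eq_zero]
    simp only [← map_smul]
    rw [← map_sum, ← map_sub]
    refine fracRes_eq_zero hD hs hl ?_
    rw [hexpand] at htrunc
    have h1 := Ideal.mul_mem_right (U⁻¹ * ∏ j : Fin r, expVar ε j.castSucc) _ htrunc
    rw [sub_mul, Finset.sum_mul] at h1
    simpa only [pullback, smul_mul_assoc] using h1
  rw [hpull]
  have hsub : Finset.piAntidiag (Finset.univ : Finset (Fin r)) d ⊆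
      Fintype.piFinset fun _ : Fin r => Finset.range (d + 1) := by
    intro i hi
    refine Fintype.mem_piFinset.mpr fun j => Finset.mem_range.mpr (Nat.lt_succ_of_le ?_)
    rw [← (Finset.mem_piAntidiag.mp hi).1]
    exact Finset.single_le_sum (fun k _ => Nat.zero_le (i k)) (Finset.mem_univ j)
  rw [← Finset.sum_subset hsub]
  · refine Finset.sum_congr rfl fun i hi => ?_
    rw [fracRes_pullback hD hs hl hV (by rw [hcard]; omega),
      if_pos (Finset.mem_piAntidiag.mp hi).1, fCoeff_eq]
  -- Exponents in the box of total degree other than d contribute nothing.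
  · intro i _ hi
    rw [fracRes_pullback hD hs hl hV (by rw [hcard]; omega), if_neg, smul_zero]
    intro h1
    exact hi (Finset.mem_piAntidiag.mpr ⟨h1, fun _ _ => Finset.mem_univ _⟩)

/-! ### Multiplicities as numbers of edges at a vertex -/

theorem root_inj {i j i' j' : Fin (r + 1)} (hij : i < j) (hij' : i' < j')
    (h : root i j = root i' j') : i = i' ∧ j = j' := by
  have h1 := congrFun h i
  rw [root_apply_self hij.ne] at h1
  have h2 := congrFun h j
  have hi : i = i' := by
    by_contra hne
    rw [root] at h1
    simp only [Pi.sub_apply, Pi.single_apply, if_neg hne] at h1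
    split_ifs at h1 <;> norm_num at h1
  subst hi
  refine ⟨rfl, ?_⟩
  by_contra hne
  simp [root, hij.ne', hne] at h2

theorem sum_mult_right {p q : Fin N → Fin (r + 1)} (hlt : ∀ k, p k < q k)
    (hpq : ∀ k, Φ k = root (p k) (q k)) (j : Fin (r + 1)) :
    ∑ l ∈ Finset.Ioi j, (mult Φ j l : ℝ) = ∑ k, if p k = j then 1 else 0 := by
  classical
  have h1 : ∀ l ∈ Finset.Ioi j, (mult Φ j l : ℝ) =
      ∑ k, if p k = j then (if q k = l then 1 else 0) else 0 := by
    intro l hl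
    rw [mult, Nat.card_eq_fintype_card, Fintype.card_subtype, Finset.card_filter]
    push_cast
    refine Finset.sum_congr rfl fun k _ => ?_
    by_cases hk : Φ k = root j l
    · obtain ⟨h1, h2⟩ := root_inj (hlt k) (Finset.mem_Ioi.mp hl) ((hpq k).symm.trans hk)
      rw [if_pos hk, if_pos h1, if_pos h2]
    · rw [if_neg hk]
      split_ifs with h2 h3
      · exact absurd (by rw [hpq, h2, h3]) hk
      all_goals rfl
  rw [Finset.sum_congr rfl h1, Finset.sum_comm]
  refine Finset.sum_congr rfl fun k _ => ?_
  split_ifs with h2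
  · rw [Finset.sum_ite_eq, if_pos (Finset.mem_Ioi.mpr (h2 ▸ hlt k))]
  · exact Finset.sum_const_zero

theorem sum_mult_left {p q : Fin N → Fin (r + 1)} (hlt : ∀ k, p k < q k)
    (hpq : ∀ k, Φ k = root (p k) (q k)) (j : Fin (r + 1)) :
    ∑ l ∈ Finset.Iio j, (mult Φ l j : ℝ) = ∑ k, if q k = j then 1 else 0 := by
  classical
  have h1 : ∀ l ∈ Finset.Iio j, (mult Φ l j : ℝ) =
      ∑ k, if q k = j then (if p k = l then 1 else 0) else 0 := by
    intro l hl
    rw [mult, Nat.card_eq_fintype_card, Fintype.card_subtype, Finset.card_filter]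
    push_cast
    refine Finset.sum_congr rfl fun k _ => ?_
    by_cases hk : Φ k = root l j
    · obtain ⟨h1, h2⟩ := root_inj (hlt k) (Finset.mem_Iio.mp hl) ((hpq k).symm.trans hk)
      rw [if_pos hk, if_pos h2, if_pos h1]
    · rw [if_neg hk]
      split_ifs with h2 h3
      · exact absurd (by rw [hpq, h2, h3]) hk
      all_goals rfl
  rw [Finset.sum_congr rfl h1, Finset.sum_comm]
  refine Finset.sum_congr rfl fun k _ => ?_
  split_ifs with h2
  · rw [Finset.sum_ite_eq, if_pos (Finset.mem_Iio.mpr (h2 ▸ hlt k))]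
  · exact Finset.sum_const_zero

theorem K_eq_sum_binom (hD : D ⊆ posRoots r) (hΦ : ∀ k, Φ k ∈ D)
    (hspan : Submodule.span ℝ (Set.range Φ) = rootSpace r) (a : Fin r → ℝ) :
    K (symm D) Φ a = ∑ i ∈ Finset.piAntidiag (Finset.univ : Finset (Fin r)) (N - r),
      (∏ k, binom (a k + tShift Φ k) (i k)) • fCoeff (symm D) Φ i := by
  choose p q hlt hpq using fun k => hD (hΦ k)
  simp only [← stepBinom_one]
  refine K_eq_sum hD hΦ hspan (by norm_num) hpq (h := fun k => Pi.single (p k) 1) (fun k => ?_) a _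
    fun j => ?_
  -- For ε = 1 the factorization is e^{x_p} - e^{x_q} = e^{x_p}(1 - e^{-(x_p - x_q)}). Each root
  -- thus shifts the exponent at its starting vertex by 1, and the Jacobian accounts for the -1 in
  -- t_j.
  · have h1 : (Pi.single (q k) 1 : Fin (r + 1) → ℝ) = Pi.single (p k) 1 + -Φ k := by
      rw [hpq, root]
      abel
    simp only [newVar, expVar, one_smul]
    rw [mul_sub, ← expForm_add, ← h1]
    ring
  · rw [tShift, sum_mult_right hlt hpq]
    simp only [Pi.single_apply, eq_comm]
    ring

theorem K_eq_sum_risingBinom (hD : D ⊆ posRoots r) (hΦ : ∀ k, Φ k ∈ D)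
    (hspan : Submodule.span ℝ (Set.range Φ) = rootSpace r) (a : Fin r → ℝ) :
    K (symm D) Φ a = ∑ i ∈ Finset.piAntidiag (Finset.univ : Finset (Fin r)) (N - r),
      (∏ k, risingBinom (a k + sShift Φ k) (i k)) • fCoeff (symm D) Φ i := by
  choose p q hlt hpq using fun k => hD (hΦ k)
  simp only [← stepBinom_neg_one]
  refine K_eq_sum hD hΦ hspan (by norm_num) hpq (h := fun k => -Pi.single (q k) 1) (fun k => ?_) a _
    fun j => ?_
  -- For ε = -1 the factorization is e^{-x_q} - e^{-x_p} = e^{-x_q}(1 - e^{-(x_p - x_q)}). Each root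
  -- shifts the exponent at its end vertex by -1, and the Jacobian accounts for the +1 in s_j.
  · have h1 : (-Pi.single (p k) 1 : Fin (r + 1) → ℝ) = -Pi.single (q k) 1 + -Φ k := by
      rw [hpq, root]
      abel
    simp only [newVar, expVar, neg_smul, one_smul]
    rw [mul_sub, ← expForm_add, ← h1]
    ring
  · rw [sShift, sum_mult_left hlt hpq]
    simp only [Pi.neg_apply, Pi.single_apply, eq_comm, Finset.sum_neg_distrib]
    ring

end Formulas

end

end TotalRes

theorem mainTheorem1 (r N : ℕ) (Φ : Fin N → Fin (r + 1) → ℝ)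
    (hspan : Submodule.span ℝ (Set.range Φ) = TotalRes.rootSpace r)
    (D : Set (Fin (r + 1) → ℝ)) (hD : D ⊆ TotalRes.posRoots r) (hΦ : ∀ k, Φ k ∈ D)
    (Δ : Set (Fin (r + 1) → ℝ)) (hΔ : Δ = TotalRes.symm D) :
    -- the decomposition `R_Δ = S_Δ ⊕ ∂(V) R_Δ`, so that the total residue is a projection
    (TotalRes.simpleSpace Δ ⊔ TotalRes.derivSpace Δ =
        Subalgebra.toSubmodule (TotalRes.ratRing Δ) ∧
      Disjoint (TotalRes.simpleSpace Δ) (TotalRes.derivSpace Δ)) ∧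
    (∀ a : Fin r → ℝ, TotalRes.J Δ Φ a =
      ∑ i ∈ Finset.piAntidiag (Finset.univ : Finset (Fin r)) (N - r),
        (∏ k, a k ^ i k / ((i k).factorial : ℝ)) • TotalRes.fCoeff Δ Φ i) ∧
    (∀ a : Fin r → ℝ, TotalRes.K Δ Φ a =
      ∑ i ∈ Finset.piAntidiag (Finset.univ : Finset (Fin r)) (N - r),
        (∏ k, TotalRes.binom (a k + TotalRes.tShift Φ k) (i k)) • TotalRes.fCoeff Δ Φ i) ∧
    (∀ a : Fin r → ℝ, TotalRes.K Δ Φ a =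
      ∑ i ∈ Finset.piAntidiag (Finset.univ : Finset (Fin r)) (N - r),
        (∏ k, TotalRes.risingBinom (a k + TotalRes.sShift Φ k) (i k)) •
          TotalRes.fCoeff Δ Φ i) := by
  subst hΔ
  exact ⟨⟨TotalRes.simpleSpace_sup_derivSpace
      (fun _ hα => TotalRes.linForm_ne_zero hD hα) (TotalRes.span_symm hD hΦ hspan),
      TotalRes.disjoint_simpleSpace_derivSpace hD _⟩,
    TotalRes.J_eq_sum hD hΦ hspan, TotalRes.K_eq_sum_binom hD hΦ hspan,
    TotalRes.K_eq_sum_risingBinom hD hΦ hspan⟩
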